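/- Let $n\ge 2$, let $\Omega\subset\mathbb R^n$ be a bounded open set and let $1<p\le q\le n$. Let $\varphi:\Omega\times[0,\infty)\to[0,\infty]$ be a convex $\Phi$-function: $x\mapsto\varphi(x,s)$ is measurable for every $s\ge0$; for a.e. $x\in\Omega$ the function $s\mapsto\varphi(x,s)$ is increasing, convex and left-continuous, with $\varphi(x,0)=\lim_{s\to0^+}\varphi(x,s)=0$ and $\lim_{s\to\infty}\varphi(x,s)=\infty$; and $s\mapsto\varphi(x,s)/s$ is $L$-almost increasing on $(0,\infty)$ for a.e. $x\in\Omega$, for some $L\ge1$. (A function $f$ is $L$-almost increasing if $f(s)\le Lf(t)$, and $L$-almost decreasing if $f(t)\le Lf(s)$, whenever $s\le t$.) For $B\subset\mathbb R^n$ put $\varphi_B^+(s)=\sup_{x\in B\cap\Omega}\varphi(x,s)$, $\varphi_B^-(s)=\inf_{x\in B\cap\Omega}\varphi(x,s)$, and $(\varphi_B^-)^{-1}(\tau)=\inf\{s\ge0:\varphi_B^-(s)\ge\tau\}$ (with $\inf\emptyset=\infty$). Assume: - (A0) there is $\beta\in(0,1)$ with $\varphi_\Omega^+(\beta)\le1\le\varphi_\Omega^-(1/\beta)$;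 - (A1) there is $\beta\in(0,1)$ such that $\varphi_B^+(\beta s)\le\varphi_B^-(s)$ for every ball $B$ with $(\varphi_B^-)^{-1}(1/|B|)\ge1$ and every finite $s\in[1,(\varphi_B^-)^{-1}(1/|B|)]$; - (aInc)$_p$ there is $L_p\ge1$ such that $s\mapsto\varphi(x,s)/s^p$ is $L_p$-almost increasing on $(0,\infty)$ for a.e. $x\in\Omega$; - (aDec)$_q$ there is $L_q\ge1$ such that $s\mapsto\varphi(x,s)/s^q$ is $L_q$-almost decreasing on $(0,\infty)$ for a.e. $x\in\Omega$. Let $L^{\varphi(\cdot)}(\Omega)$ be the set of measurable $w$ on $\Omega$ with $\int_\Omega\varphi(x,|w|)\,dx<\infty$, with the norm $\|w\|_{L^{\varphi(\cdot)}(\Omega)}=\inf\{\lambda>0:\int_\Omega\varphi(x,|w|/\lambda)\,dx\le1\}$. Let $W^{1,\varphi(\cdot)}(\Omega)$ be the set of $w\in W^{1,1}(\Omega)$ with $w,|Dw|\in L^{\varphi(\cdot)}(\Omega)$, with the norm $\|w\|_{L^{\varphi(\cdot)}(\Omega)}+\|Dw\|_{L^{\varphi(\cdot)}(\Omega)}$,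 and let $W^{1,\varphi(\cdot)}_0(\Omega)$ be the closure of $C_c^\infty(\Omega)$ in $W^{1,\varphi(\cdot)}(\Omega)$. A sequence $w_j$ converges to $w$ modularly in $W^{1,\varphi(\cdot)}(\Omega)$ if $w_j\to w$ and $Dw_j\to Dw$ a.e. in $\Omega$, $\int_\Omega\varphi(x,|w_j-w|)\,dx\to0$ and $\int_\Omega\varphi(x,|Dw_j-Dw|)\,dx\to0$. For $E\subset\Omega$ relatively closed, $W^{1,\varphi(\cdot)}_0(\Omega)=W^{1,\varphi(\cdot)}_0(\Omega\setminus E)$ means that for every $w\in W^{1,\varphi(\cdot)}_0(\Omega)$ there is a sequence in $C_c^\infty(\Omega\setminus E)$ converging to $w$ modularly in $W^{1,\varphi(\cdot)}(\Omega)$. For compact $K\subset\Omega$ put $\mathrm{cap}_{\varphi(\cdot)}(K,\Omega)=\inf_f\int_\Omega\varphi(x,|Df|)\,dx$, the infimum over all $f\in W^{1,\varphi(\cdot)}(\Omega)$ that are continuous with compact support in $\Omega$ and satisfy $f\ge1$ on $K$; for open $U\subset\Omega$ put $\mathrm{cap}_{\varphi(\cdot)}(U,\Omega)=\sup\{\mathrm{cap}_{\varphi(\cdot)}(K,\Omega):K\subset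 U\text{ compact}\}$; for general $E\subset\Omega$ put $\mathrm{cap}_{\varphi(\cdot)}(E,\Omega)=\inf\{\mathrm{cap}_{\varphi(\cdot)}(U,\Omega):E\subset U\subset\Omega,\ U\text{ open}\}$. Then, for every relatively closed subset $E$ of $\Omega$, $$W^{1,\varphi(\cdot)}_0(\Omega)=W^{1,\varphi(\cdot)}_0(\Omega\setminus E)\quad\text{if and only if}\quad \mathrm{cap}_{\varphi(\cdot)}(E,\Omega)=0.$$ -/

import Mathlib

open MeasureTheory Filter Topology Set
open scoped NNReal ENNReal

namespace MusielakOrlicz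

/-! Throughout, `E n` is `ℝⁿ` with its Euclidean norm, and a function on an open set `Ω ⊆ ℝⁿ` is
represented by a function on all of `ℝⁿ` of which only the values on `Ω` are used. -/

/-- Euclidean space `ℝⁿ`. -/
abbrev E (n : ℕ) : Type := EuclideanSpace ℝ (Fin n)

/-! ### Generalized Orlicz functions -/

/-- `f` is `L`-almost increasing on `(0, ∞)`. -/
def AlmostIncreasing (L : ℝ≥0) (f : ℝ≥0 → ℝ≥0∞) : Prop :=
  ∀ s t : ℝ≥0, 0 < s → s ≤ t → f s ≤ L * f t

/-- `f` is `L`-almost decreasing on `(0, ∞)`. -/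
def AlmostDecreasing (L : ℝ≥0) (f : ℝ≥0 → ℝ≥0∞) : Prop :=
  ∀ s t : ℝ≥0, 0 < s → s ≤ t → f t ≤ L * f s

/-- Convex `Φ`-functions `φ : Ω × [0, ∞) → [0, ∞]`. (Lebesgue) measurability of `φ (·, s)` on `Ω` is
almost everywhere measurability with respect to Lebesgue measure restricted to `Ω`. -/
structure IsConvexPhi {n : ℕ} (Ω : Set (E n)) (φ : E n → ℝ≥0 → ℝ≥0∞) : Prop where
  measurable : ∀ s : ℝ≥0, AEMeasurable (fun x => φ x s) (volume.restrict Ω)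
  increasing : ∀ᵐ x ∂(volume.restrict Ω), Monotone (φ x)
  convex : ∀ᵐ x ∂(volume.restrict Ω), ConvexOn ℝ≥0 univ (φ x)
  leftContinuous : ∀ᵐ x ∂(volume.restrict Ω), ∀ s : ℝ≥0, 0 < s →
    ContinuousWithinAt (φ x) (Iic s) s
  zero : ∀ᵐ x ∂(volume.restrict Ω), φ x 0 = 0
  tendsto_zero : ∀ᵐ x ∂(volume.restrict Ω), Tendsto (φ x) (𝓝[>] 0) (𝓝 0)
  tendsto_top : ∀ᵐ x ∂(volume.restrict Ω), Tendsto (φ x) atTop (𝓝 (⊤ : ℝ≥0∞))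
  almostIncreasing : ∃ L : ℝ≥0, 1 ≤ L ∧ ∀ᵐ x ∂(volume.restrict Ω),
    AlmostIncreasing L (fun s => φ x s / (s : ℝ≥0∞))

/-- `φ⁺_B (s) = sup_{x ∈ B ∩ Ω} φ (x, s)`. -/
noncomputable def phiSup {n : ℕ} (Ω : Set (E n)) (φ : E n → ℝ≥0 → ℝ≥0∞) (B : Set (E n))
    (s : ℝ≥0) : ℝ≥0∞ :=
  ⨆ x ∈ B ∩ Ω, φ x s

/-- `φ⁻_B (s) = inf_{x ∈ B ∩ Ω} φ (x, s)`. -/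
noncomputable def phiInf {n : ℕ} (Ω : Set (E n)) (φ : E n → ℝ≥0 → ℝ≥0∞) (B : Set (E n))
    (s : ℝ≥0) : ℝ≥0∞ :=
  ⨅ x ∈ B ∩ Ω, φ x s

/-- The generalized inverse `g⁻¹ (τ) = inf {s ≥ 0 : g (s) ≥ τ}`, with `inf ∅ = ∞`. -/
noncomputable def leftInv (g : ℝ≥0 → ℝ≥0∞) (τ : ℝ≥0∞) : ℝ≥0∞ :=
  ⨅ (s : ℝ≥0) (_ : τ ≤ g s), (s : ℝ≥0∞)

/-- Condition (A0): `φ⁺ (β) ≤ 1 ≤ φ⁻ (1/β)` for some `β ∈ (0, 1)`. -/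
def CondA0 {n : ℕ} (Ω : Set (E n)) (φ : E n → ℝ≥0 → ℝ≥0∞) : Prop :=
  ∃ β : ℝ≥0, 0 < β ∧ β < 1 ∧ phiSup Ω φ univ β ≤ 1 ∧ 1 ≤ phiInf Ω φ univ β⁻¹

/-- Condition (A1): for some `β ∈ (0, 1)` and all balls `B` with `(φ⁻_B)⁻¹ (1/|B|) ≥ 1` one has
`φ⁺_B (β s) ≤ φ⁻_B (s)` for all `s ∈ [1, (φ⁻_B)⁻¹ (1/|B|)]`. -/
def CondA1 {n : ℕ} (Ω : Set (E n)) (φ : E n → ℝ≥0 → ℝ≥0∞) : Prop :=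
  ∃ β : ℝ≥0, 0 < β ∧ β < 1 ∧ ∀ (z : E n) (r : ℝ), 0 < r →
    1 ≤ leftInv (phiInf Ω φ (Metric.ball z r)) (volume (Metric.ball z r))⁻¹ →
    ∀ s : ℝ≥0, 1 ≤ s →
      (s : ℝ≥0∞) ≤ leftInv (phiInf Ω φ (Metric.ball z r)) (volume (Metric.ball z r))⁻¹ →
      phiSup Ω φ (Metric.ball z r) (β * s) ≤ phiInf Ω φ (Metric.ball z r) s

/-- Condition (aInc)_p. -/
def CondAInc {n : ℕ} (Ω : Set (E n)) (φ : E n → ℝ≥0 → ℝ≥0∞) (p : ℝ) : Prop :=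
  ∃ L : ℝ≥0, 1 ≤ L ∧ ∀ᵐ x ∂(volume.restrict Ω),
    AlmostIncreasing L (fun s => φ x s / (s : ℝ≥0∞) ^ p)

/-- Condition (aDec)_q. -/
def CondADec {n : ℕ} (Ω : Set (E n)) (φ : E n → ℝ≥0 → ℝ≥0∞) (q : ℝ) : Prop :=
  ∃ L : ℝ≥0, 1 ≤ L ∧ ∀ᵐ x ∂(volume.restrict Ω),
    AlmostDecreasing L (fun s => φ x s / (s : ℝ≥0∞) ^ q)

/-! ### Musielak–Orlicz–Sobolev spaces -/

/-- The modular `∫_Ω φ (x, |g|) dx` of a scalar or vector valued function `g`. -/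
noncomputable def modular {n : ℕ} {F : Type*} [NormedAddCommGroup F] (Ω : Set (E n))
    (φ : E n → ℝ≥0 → ℝ≥0∞) (g : E n → F) : ℝ≥0∞ :=
  ∫⁻ x in Ω, φ x ‖g x‖₊

/-- The Luxemburg norm `inf {l > 0 : ∫_Ω φ (x, |g| / l) dx ≤ 1}`, with `inf ∅ = ∞`. -/
noncomputable def luxemburgNorm {n : ℕ} {F : Type*} [NormedAddCommGroup F] (Ω : Set (E n))
    (φ : E n → ℝ≥0 → ℝ≥0∞) (g : E n → F) : ℝ≥0∞ :=
  ⨅ (l : ℝ≥0) (_ : 0 < l ∧ ∫⁻ x in Ω, φ x (‖g x‖₊ / l) ≤ 1), (l : ℝ≥0∞)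

/-- `η ∈ C_c^∞(U)`. -/
structure IsTestFunction {n : ℕ} (U : Set (E n)) (η : E n → ℝ) : Prop where
  smooth : ContDiff ℝ ((⊤ : ℕ∞) : WithTop ℕ∞) η
  compactSupport : HasCompactSupport η
  support_subset : tsupport η ⊆ U

/-- `w ∈ W^{1,φ(·)}(Ω)` with weak gradient `G = Dw`: both are integrable on `Ω`, `G` is the
distributional gradient of `w` in `Ω`, and both have finite modular. -/
structure IsSobolev {n : ℕ} (Ω : Set (E n)) (φ : E n → ℝ≥0 → ℝ≥0∞) (w : E n → ℝ)
    (G : E n → E n) : Prop where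
  integrable : IntegrableOn w Ω
  integrable_grad : IntegrableOn G Ω
  weak_grad : ∀ η : E n → ℝ, IsTestFunction Ω η → ∀ v : E n,
    ∫ x in Ω, w x * fderiv ℝ η x v = - ∫ x in Ω, inner ℝ (G x) v * η x
  modular_lt : modular Ω φ w < ⊤
  modular_grad_lt : modular Ω φ G < ⊤

/-- `w ∈ W_0^{1,φ(·)}(Ω)` with weak gradient `G = Dw`: `w` lies in the closure of `C_c^∞(Ω)` in
`W^{1,φ(·)}(Ω)` for the norm `‖w‖_{L^φ} + ‖Dw‖_{L^φ}`. -/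
structure IsSobolevZero {n : ℕ} (Ω : Set (E n)) (φ : E n → ℝ≥0 → ℝ≥0∞) (w : E n → ℝ)
    (G : E n → E n) : Prop where
  isSobolev : IsSobolev Ω φ w G
  approx : ∀ ε : ℝ≥0∞, 0 < ε → ∃ η : E n → ℝ, IsTestFunction Ω η ∧
    luxemburgNorm Ω φ (fun x => η x - w x)
      + luxemburgNorm Ω φ (fun x => gradient η x - G x) < ε

/-- Modular convergence `g_j → g` in `L^φ(·)(Ω)`: convergence almost everywhere in `Ω` and
`∫_Ω φ (x, |g_j - g|) dx → 0`. -/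
def ModularTendsto {n : ℕ} {F : Type*} [NormedAddCommGroup F] (Ω : Set (E n))
    (φ : E n → ℝ≥0 → ℝ≥0∞) (u : ℕ → E n → F) (g : E n → F) : Prop :=
  (∀ᵐ x ∂(volume.restrict Ω), Tendsto (fun j => u j x) atTop (𝓝 (g x))) ∧
    Tendsto (fun j => modular Ω φ (fun x => u j x - g x)) atTop (𝓝 0)

/-- The relation `W_0^{1,φ(·)}(Ω) = W_0^{1,φ(·)}(Ω \ A)`: every `w ∈ W_0^{1,φ(·)}(Ω)` is the limit
of a sequence in `C_c^∞(Ω \ A)` with respect to modular convergence in `W^{1,φ(·)}(Ω)`, that is,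
modular convergence of the functions and of their gradients. -/
def SobolevZeroEqDiff {n : ℕ} (Ω : Set (E n)) (φ : E n → ℝ≥0 → ℝ≥0∞) (A : Set (E n)) : Prop :=
  ∀ (w : E n → ℝ) (G : E n → E n), IsSobolevZero Ω φ w G →
    ∃ u : ℕ → E n → ℝ, (∀ j, IsTestFunction (Ω \ A) (u j)) ∧
      ModularTendsto Ω φ u w ∧ ModularTendsto Ω φ (fun j => gradient (u j)) G

/-! ### Relative capacity -/

/-- `f` is admissible for the capacity of `K` and has weak gradient `G`: `f ∈ W^{1,φ(·)}(Ω)` is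
continuous with compact support in `Ω`, and `f ≥ 1` on `K`. -/
structure IsAdmissible {n : ℕ} (Ω : Set (E n)) (φ : E n → ℝ≥0 → ℝ≥0∞) (K : Set (E n))
    (f : E n → ℝ) (G : E n → E n) : Prop where
  isSobolev : IsSobolev Ω φ f G
  continuous : Continuous f
  compactSupport : HasCompactSupport f
  support_subset : tsupport f ⊆ Ω
  one_le : ∀ x ∈ K, 1 ≤ f x

/-- `cap(K, Ω)` for compact `K ⊆ Ω`. -/
noncomputable def capCompact {n : ℕ} (Ω : Set (E n)) (φ : E n → ℝ≥0 → ℝ≥0∞)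
    (K : Set (E n)) : ℝ≥0∞ :=
  ⨅ (f : E n → ℝ) (G : E n → E n) (_ : IsAdmissible Ω φ K f G), modular Ω φ G

/-- `cap(U, Ω)` for open `U ⊆ Ω`. -/
noncomputable def capOpen {n : ℕ} (Ω : Set (E n)) (φ : E n → ℝ≥0 → ℝ≥0∞)
    (U : Set (E n)) : ℝ≥0∞ :=
  ⨆ (K : Set (E n)) (_ : IsCompact K ∧ K ⊆ U), capCompact Ω φ K

/-- The relative capacity `cap(A, Ω)` of a general set `A ⊆ Ω`. -/
noncomputable def capacity {n : ℕ} (Ω : Set (E n)) (φ : E n → ℝ≥0 → ℝ≥0∞)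
    (A : Set (E n)) : ℝ≥0∞ :=
  ⨅ (U : Set (E n)) (_ : IsOpen U ∧ A ⊆ U ∧ U ⊆ Ω), capOpen Ω φ U

end MusielakOrlicz

open MusielakOrlicz

/-! Convexity, (A0) and (aDec) reduce to the pointwise facts in `DoublingPhi`, shared by a.e. `φ x`.
These make the modular quasi-subadditive, let it control the `L¹` norm, and conversely bound it by
the `L¹` norm on uniformly bounded functions. Removable implies null: a cutoff `η`, equal to `1`
near a compact piece of `Ω`, is approximated by some `u` vanishing near `A`. Then `η - u` equals `1`
on a neighbourhood of that part of `A` and has a small gradient (`exists_capacity_test_near`).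
Countably many such functions, with summable errors, show that `A` is null. Null implies removable:
for a test function `η`, an admissible `f` for the compact set `tsupport η ∩ A` with small gradient
modular is mollified to a smooth `v` and truncated to `h = ψ ∘ v`, which is `1` near this set. Then
`η (1 - h)` is a test function off `A`. The error `h η` and the part `h ∇η` of the gradient error
are bounded, so they are controlled by the `L¹` norm of `h`, hence through the `L¹` Poincaré
inequality by that of the gradient of `f`. The part `η ∇h` requires a modular bound for the
mollified gradient that is uniform in the mollification radius, which depends on `f`. This is where
(A1) enters, through the Jensen-type estimate `exists_phi_mollify_le`. -/

namespace MusielakOrlicz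

/-! ### Pointwise bounds for doubling convex functions -/

/-- A doubling left-continuous convex function `f` with `f β ≤ 1 ≤ f β⁻¹`; only the consequences of
convexity that are needed are recorded. -/
structure DoublingPhi (β : ℝ≥0) (C : ℝ≥0 → ℝ≥0) (f : ℝ≥0 → ℝ≥0∞) : Prop where
  mono : Monotone f
  zero : f 0 = 0
  leftContinuous : ∀ s : ℝ≥0, 0 < s → ContinuousWithinAt f (Iic s) s
  scale : ∀ l t : ℝ≥0, l ≤ 1 → f (l * t) ≤ l * f t
  doubling : ∀ k t : ℝ≥0, f (k * t) ≤ C k * f t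
  le_one : f β ≤ 1
  one_le : 1 ≤ f β⁻¹

namespace DoublingPhi

variable {β : ℝ≥0} {C : ℝ≥0 → ℝ≥0} {f : ℝ≥0 → ℝ≥0∞}

theorem le_const (h : DoublingPhi β C f) (hβ : 0 < β) (t : ℝ≥0) : f t ≤ C (t / β) := by
  have h1 := h.doubling (t / β) β
  rw [div_mul_cancel₀ _ hβ.ne'] at h1
  exact h1.trans ((mul_le_mul_right h.le_one _).trans (by simp))

theorem ne_top (h : DoublingPhi β C f) (hβ : 0 < β) (t : ℝ≥0) : f t ≠ ∞ :=
  ne_top_of_le_ne_top ENNReal.coe_ne_top (h.le_const hβ t)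

theorem mul_le_mul (h : DoublingPhi β C f) {s t : ℝ≥0} (hst : s ≤ t) : t * f s ≤ s * f t := by
  rcases eq_or_ne t 0 with rfl | ht
  · simp
  have h1 := h.scale (s / t) t (div_le_one_of_le₀ hst zero_le)
  rw [div_mul_cancel₀ _ ht] at h1
  calc (t : ℝ≥0∞) * f s ≤ t * (((s / t : ℝ≥0) : ℝ≥0∞) * f t) := by gcongr
    _ = s * f t := by rw [← mul_assoc, ← ENNReal.coe_mul, mul_div_cancel₀ _ ht]

theorem le_linear (h : DoublingPhi β C f) (hβ : 0 < β) {t T : ℝ≥0} (hT : 0 < T) (ht : t ≤ T) :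
    f t ≤ (C (T / β) / T : ℝ≥0) * t := by
  have h1 := h.scale (t / T) T (div_le_one_of_le₀ ht zero_le)
  rw [div_mul_cancel₀ _ hT.ne'] at h1
  calc f t ≤ (t / T : ℝ≥0) * (C (T / β) : ℝ≥0∞) := h1.trans (by gcongr; exact h.le_const hβ T)
    _ = _ := by
      rw [← ENNReal.coe_mul, ← ENNReal.coe_mul]
      congr 1
      ring

/-- For `t ≥ d`, the quotient `f t / t` is at least `f d / d`, and doubling bounds `f d` from below
because `1 ≤ f β⁻¹`. With `d` arbitrary, a small modular forces a small `L¹` norm on a set of finite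
measure. -/
theorem le_add (h : DoublingPhi β C f) {d : ℝ≥0} (hd : 0 < d) (t : ℝ≥0) :
    (t : ℝ≥0∞) ≤ d + (d * C (β⁻¹ / d) : ℝ≥0) * f t := by
  rcases le_total t d with ht | ht
  · exact (ENNReal.coe_le_coe.2 ht).trans le_self_add
  · refine le_trans ?_ le_add_self
    have h1 := h.doubling (β⁻¹ / d) d
    rw [div_mul_cancel₀ _ hd.ne'] at h1
    calc (t : ℝ≥0∞) ≤ t * (C (β⁻¹ / d) * f d) := by
          simpa using mul_le_mul_right (h.one_le.trans h1) (t : ℝ≥0∞)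
      _ = C (β⁻¹ / d) * (t * f d) := by ring
      _ ≤ C (β⁻¹ / d) * (d * f t) := by gcongr _ * ?_; exact h.mul_le_mul ht
      _ = _ := by push_cast; ring

theorem add_le (h : DoublingPhi β C f) (a b : ℝ≥0) : f (a + b) ≤ C 2 * f a + C 2 * f b := by
  rcases le_total a b with hab | hab
  · exact ((h.mono (by rw [two_mul]; gcongr)).trans (h.doubling 2 b)).trans le_add_self
  · exact ((h.mono (by rw [two_mul]; gcongr)).trans (h.doubling 2 a)).trans le_self_add

/-- Some term satisfies `a j ≥ 2 ^ (-(j + 1)) S`, since these weights sum to at most `1`; doubling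
applied to that term suffices. The coefficients do not depend on `N`, so errors can be budgeted in
advance for infinitely many functions. -/
theorem sum_le (h : DoublingPhi β C f) (a : ℕ → ℝ≥0) (N : ℕ) :
    f (∑ j ∈ Finset.range N, a j) ≤ ∑ j ∈ Finset.range N, C (2 ^ (j + 1)) * f (a j) := by
  set S := ∑ j ∈ Finset.range N, a j with hS
  rcases eq_or_ne S 0 with h0 | h0
  · simp [h0, h.zero]
  obtain ⟨j, hj, hja⟩ : ∃ j ∈ Finset.range N, S ≤ 2 ^ (j + 1) * a j := by
    by_contra! hc
    have hne : (Finset.range N).Nonempty := by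
      rw [Finset.nonempty_iff_ne_empty]
      rintro he
      simp [hS, he] at h0
    have h1 : S < ∑ j ∈ Finset.range N, (1 / 2) ^ (j + 1) * S := by
      rw [hS]
      refine Finset.sum_lt_sum_of_nonempty hne fun j hj => ?_
      have := hc j hj
      rw [← hS]
      calc a j = (1 / 2) ^ (j + 1) * (2 ^ (j + 1) * a j) := by
            rw [← mul_assoc, ← mul_pow]; norm_num
        _ < _ := by gcongr
    rw [← Finset.sum_mul] at h1
    have h2 : ∑ j ∈ Finset.range N, (1 / 2 : ℝ≥0) ^ (j + 1) ≤ 1 := by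
      have : ∀ N : ℕ, ∑ j ∈ Finset.range N, (1 / 2 : ℝ≥0) ^ (j + 1) + (1 / 2) ^ N = 1 := by
        intro N
        induction N with
        | zero => simp
        | succ k ih =>
          refine Eq.trans ?_ ih
          rw [Finset.sum_range_succ, add_assoc]
          congr 1
          rw [pow_succ, ← mul_add]
          norm_num
      exact le_self_add.trans (this N).le
    exact absurd (h1.trans_le (mul_le_mul_left h2 S)) (by simp)
  calc f S ≤ f (2 ^ (j + 1) * a j) := h.mono hja
    _ ≤ C (2 ^ (j + 1)) * f (a j) := h.doubling _ _
    _ ≤ _ := Finset.single_le_sum (f := fun j => (C (2 ^ (j + 1)) : ℝ≥0∞) * f (a j))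
      (fun _ _ => zero_le) hj

theorem tendsto_zero (h : DoublingPhi β C f) {a : ℕ → ℝ≥0}
    (ha : Tendsto (fun j => f (a j)) atTop (𝓝 0)) : Tendsto a atTop (𝓝 0) := by
  rw [← ENNReal.tendsto_coe, ENNReal.coe_zero, ENNReal.tendsto_nhds_zero]
  intro ε hε
  obtain ⟨d, hd, hdε⟩ := ENNReal.lt_iff_exists_nnreal_btwn.1 hε
  have hd2 : 0 < d / 2 := by simpa using hd
  have h1 : Tendsto (fun j => ((d / 2 * C (β⁻¹ / (d / 2)) : ℝ≥0) : ℝ≥0∞) * f (a j)) atTop (𝓝 0) := by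
    simpa using ENNReal.Tendsto.const_mul (a := ((d / 2 * C (β⁻¹ / (d / 2)) : ℝ≥0) : ℝ≥0∞)) ha
      (Or.inr ENNReal.coe_ne_top)
  filter_upwards [(ENNReal.tendsto_nhds_zero.1 h1) (d / 2 : ℝ≥0) (by exact_mod_cast hd2)] with j hj
  calc (a j : ℝ≥0∞) ≤ _ := h.le_add hd2 (a j)
    _ ≤ (d / 2 : ℝ≥0) + (d / 2 : ℝ≥0) := by gcongr
    _ = d := by rw [← ENNReal.coe_add, add_halves]
    _ ≤ ε := hdε.le

end DoublingPhi

/-! ### The modular -/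

section Modular

variable {n : ℕ} {Ω : Set (E n)} {φ : E n → ℝ≥0 → ℝ≥0∞}

theorem exists_doublingPhi (hΩ : IsOpen Ω) (hφ : IsConvexPhi Ω φ) (hA0 : CondA0 Ω φ) {q : ℝ}
    (hq : 0 ≤ q) (hDec : CondADec Ω φ q) :
    ∃ β C, 0 < β ∧ ∀ᵐ x ∂(volume.restrict Ω), DoublingPhi β C (φ x) := by
  obtain ⟨β, hβ, -, hs, hi⟩ := hA0
  obtain ⟨L, hL, hD⟩ := hDec
  -- The summand `1` serves `k ≤ 1`, by monotonicity; `L * k ^ q` serves `k ≥ 1`, by (aDec).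
  refine ⟨β, fun k => 1 + L * k ^ q, hβ, ?_⟩
  filter_upwards [hφ.increasing, hφ.convex, hφ.leftContinuous, hφ.zero, hD,
    ae_restrict_mem hΩ.measurableSet] with x hm hc hl h0 hd hx
  refine ⟨hm, h0, hl, fun l t hlt => ?_, fun k t => ?_, ?_, ?_⟩
  · have := hc.2 (mem_univ t) (mem_univ 0) (zero_le (a := l)) (zero_le (a := 1 - l))
      (add_tsub_cancel_of_le hlt)
    simpa [h0, ENNReal.smul_def] using this
  · push_cast
    rcases le_total k 1 with hk | hk
    · calc φ x (k * t) ≤ φ x t := hm (mul_le_of_le_one_left zero_le hk)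
        _ ≤ _ := le_mul_of_one_le_left zero_le le_self_add
    rcases eq_or_ne t 0 with rfl | ht
    · simp [h0]
    have ht' : 0 < t := pos_iff_ne_zero.2 ht
    have hk' : 0 < k := lt_of_lt_of_le one_pos hk
    have h1 := hd t (k * t) ht' (le_mul_of_one_le_left zero_le hk)
    have hne : ((t : ℝ≥0∞)) ^ q ≠ 0 := by
      rw [← ENNReal.coe_rpow_of_ne_zero ht]; simp [ht]
    have hnt : ((t : ℝ≥0∞)) ^ q ≠ ∞ := ENNReal.rpow_ne_top_of_nonneg hq ENNReal.coe_ne_top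
    have hkne : ((k * t : ℝ≥0) : ℝ≥0∞) ^ q ≠ 0 := by
      rw [← ENNReal.coe_rpow_of_ne_zero (by positivity)]; simp [ht, hk'.ne']
    have hknt : ((k * t : ℝ≥0) : ℝ≥0∞) ^ q ≠ ∞ :=
      ENNReal.rpow_ne_top_of_nonneg hq ENNReal.coe_ne_top
    calc φ x (k * t) = φ x (k * t) / ((k * t : ℝ≥0) : ℝ≥0∞) ^ q * ((k * t : ℝ≥0) : ℝ≥0∞) ^ q :=
          (ENNReal.div_mul_cancel hkne hknt).symm
      _ ≤ L * (φ x t / (t : ℝ≥0∞) ^ q) * ((k * t : ℝ≥0) : ℝ≥0∞) ^ q := by gcongr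
      _ = L * (k : ℝ≥0∞) ^ q * (φ x t / (t : ℝ≥0∞) ^ q * (t : ℝ≥0∞) ^ q) := by
          rw [ENNReal.coe_mul, ENNReal.mul_rpow_of_nonneg _ _ hq]; ring
      _ = L * (k : ℝ≥0∞) ^ q * φ x t := by rw [ENNReal.div_mul_cancel hne hnt]
      _ ≤ _ := by
          rw [ENNReal.coe_rpow_of_nonneg _ hq]
          gcongr
          exact le_add_self
  · exact (le_iSup₂ (f := fun y (_ : y ∈ univ ∩ Ω) => φ y β) x ⟨mem_univ x, hx⟩).trans hs
  · exact hi.trans (iInf₂_le (f := fun y (_ : y ∈ univ ∩ Ω) => φ y β⁻¹) x ⟨mem_univ x, hx⟩)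

/-- By monotonicity and left-continuity, `φ x (g x)` is the supremum of `φ x r` over `r < g x` in a
countable dense set. At `g x = 0` there is no such `r`, and both sides vanish. -/
theorem aemeasurable_phi (hm : ∀ s : ℝ≥0, AEMeasurable (fun x => φ x s) (volume.restrict Ω))
    {β : ℝ≥0} {C : ℝ≥0 → ℝ≥0} (hφ : ∀ᵐ x ∂(volume.restrict Ω), DoublingPhi β C (φ x))
    {g : E n → ℝ≥0} (hg : AEMeasurable g (volume.restrict Ω)) :
    AEMeasurable (fun x => φ x (g x)) (volume.restrict Ω) := by
  obtain ⟨D, hDc, hDd⟩ := TopologicalSpace.exists_countable_dense ℝ≥0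
  have : Countable D := hDc.to_subtype
  have h1 : AEMeasurable (fun x => ⨆ r : D, {y | (r : ℝ≥0) < hg.mk g y}.indicator
      (fun y => φ y r) x) (volume.restrict Ω) :=
    AEMeasurable.iSup fun r => (hm r).indicator (measurableSet_lt measurable_const
      hg.measurable_mk)
  refine h1.congr ?_
  filter_upwards [hφ, hg.ae_eq_mk] with x hx hgx
  apply le_antisymm
  · refine iSup_le fun r => ?_
    by_cases hr : (r : ℝ≥0) < g x
    · rw [indicator_of_mem (by simpa [← hgx] using hr)]
      exact hx.mono hr.le
    · rw [indicator_of_notMem (by simpa [← hgx] using hr)]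
      exact zero_le
  · rcases eq_or_ne (g x) 0 with h0 | h0
    · rw [h0, hx.zero]; exact zero_le
    have hpos : 0 < g x := pos_iff_ne_zero.2 h0
    refine le_of_forall_lt fun c hc => ?_
    have h2 : ∀ᶠ s in 𝓝[<] (g x), c < φ x s :=
      ((hx.leftContinuous _ hpos).mono Iio_subset_Iic_self).eventually (lt_mem_nhds hc)
    obtain ⟨a, ha, hac⟩ := (mem_nhdsLT_iff_exists_Ioo_subset' hpos).1 h2
    obtain ⟨r, hrD, hr⟩ := hDd.exists_between ha
    refine (hac hr).trans_le ?_
    refine le_trans ?_ (le_iSup _ (⟨r, hrD⟩ : D))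
    rw [indicator_of_mem (by simpa [← hgx] using hr.2)]

variable {F : Type*} [NormedAddCommGroup F]

theorem modular_le_mul {β : ℝ≥0} {C : ℝ≥0 → ℝ≥0}
    (hφ : ∀ᵐ x ∂(volume.restrict Ω), DoublingPhi β C (φ x)) {F' : Type*} [NormedAddCommGroup F']
    {g : E n → F} {h : E n → F'} (k : ℝ≥0) (hgh : ∀ x, ‖g x‖ ≤ k * ‖h x‖) :
    modular Ω φ g ≤ C k * modular Ω φ h := by
  rw [modular, modular, ← lintegral_const_mul' _ _ ENNReal.coe_ne_top]
  refine lintegral_mono_ae ?_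
  filter_upwards [hφ] with x hx using (hx.mono (show ‖g x‖₊ ≤ k * ‖h x‖₊ from hgh x)).trans
    (hx.doubling _ _)

theorem modular_add_le (hm : ∀ s : ℝ≥0, AEMeasurable (fun x => φ x s) (volume.restrict Ω))
    {β : ℝ≥0} {C : ℝ≥0 → ℝ≥0} (hφ : ∀ᵐ x ∂(volume.restrict Ω), DoublingPhi β C (φ x))
    {g h : E n → F} (hg : AEStronglyMeasurable g (volume.restrict Ω)) :
    modular Ω φ (fun x => g x + h x) ≤ C 2 * modular Ω φ g + C 2 * modular Ω φ h := by
  rw [modular, modular, modular, ← lintegral_const_mul' _ _ ENNReal.coe_ne_top,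
    ← lintegral_const_mul' _ _ ENNReal.coe_ne_top, ← lintegral_add_left']
  · refine lintegral_mono_ae ?_
    filter_upwards [hφ] with x hx using (hx.mono (nnnorm_add_le _ _)).trans (hx.add_le _ _)
  · exact (aemeasurable_phi hm hφ hg.nnnorm.aemeasurable).const_mul _

theorem modular_le_linear {β : ℝ≥0} {C : ℝ≥0 → ℝ≥0} (hβ : 0 < β)
    (hφ : ∀ᵐ x ∂(volume.restrict Ω), DoublingPhi β C (φ x))
    {g : E n → F} {T : ℝ≥0} (hT : 0 < T) (hg : ∀ x, ‖g x‖ ≤ T) :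
    modular Ω φ g ≤ (C (T / β) / T : ℝ≥0) * ∫⁻ x in Ω, ‖g x‖ₑ := by
  rw [modular, ← lintegral_const_mul' _ _ ENNReal.coe_ne_top]
  refine lintegral_mono_ae ?_
  filter_upwards [hφ] with x hx using hx.le_linear hβ hT (hg x)

theorem lintegral_le_modular {β : ℝ≥0} {C : ℝ≥0 → ℝ≥0}
    (hφ : ∀ᵐ x ∂(volume.restrict Ω), DoublingPhi β C (φ x))
    {g : E n → F} {d : ℝ≥0} (hd : 0 < d) :
    ∫⁻ x in Ω, ‖g x‖ₑ ≤ d * volume Ω + (d * C (β⁻¹ / d) : ℝ≥0) * modular Ω φ g := by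
  calc ∫⁻ x in Ω, ‖g x‖ₑ ≤ ∫⁻ x in Ω, ((d : ℝ≥0∞) + (d * C (β⁻¹ / d) : ℝ≥0) * φ x ‖g x‖₊) := by
        refine lintegral_mono_ae ?_
        filter_upwards [hφ] with x hx using hx.le_add hd _
    _ = _ := by
        rw [lintegral_add_left measurable_const, lintegral_const, Measure.restrict_apply_univ,
          lintegral_const_mul' _ _ ENNReal.coe_ne_top, modular]

theorem modular_lt_top_of_bounded (hΩb : Bornology.IsBounded Ω) {β : ℝ≥0} {C : ℝ≥0 → ℝ≥0}
    (hβ : 0 < β) (hφ : ∀ᵐ x ∂(volume.restrict Ω), DoublingPhi β C (φ x))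
    {g : E n → F} {T : ℝ≥0} (hg : ∀ x, ‖g x‖ ≤ T) : modular Ω φ g < ∞ := by
  calc modular Ω φ g ≤ ∫⁻ x in Ω, (C (T / β) : ℝ≥0∞) := by
        refine lintegral_mono_ae ?_
        filter_upwards [hφ] with x hx using (hx.mono (hg x)).trans (hx.le_const hβ T)
    _ < ∞ := by
        rw [lintegral_const, Measure.restrict_apply_univ]
        exact ENNReal.mul_lt_top ENNReal.coe_lt_top hΩb.measure_lt_top

/-- For an admissible `l ≤ 1`, convexity gives `φ x |g| ≤ l * φ x (|g| / l)`. -/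
theorem modular_lt_of_luxemburgNorm_lt {β : ℝ≥0} {C : ℝ≥0 → ℝ≥0}
    (hφ : ∀ᵐ x ∂(volume.restrict Ω), DoublingPhi β C (φ x))
    {g : E n → F} {ε : ℝ≥0∞} (hε : ε ≤ 1) (hg : luxemburgNorm Ω φ g < ε) :
    modular Ω φ g < ε := by
  simp only [luxemburgNorm, iInf_lt_iff] at hg
  obtain ⟨l, ⟨hl, hl1⟩, hlε⟩ := hg
  have hle : l ≤ 1 := by exact_mod_cast (hlε.trans_le hε).le
  refine lt_of_le_of_lt ?_ hlε
  calc modular Ω φ g ≤ ∫⁻ x in Ω, l * φ x (‖g x‖₊ / l) := by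
        refine lintegral_mono_ae ?_
        filter_upwards [hφ] with x hx
        have := hx.scale l (‖g x‖₊ / l) hle
        rwa [mul_div_cancel₀ _ hl.ne'] at this
    _ ≤ l := by
        rw [lintegral_const_mul' _ _ ENNReal.coe_ne_top]
        exact (mul_le_mul_right hl1 _).trans (by simp)

theorem luxemburgNorm_zero (h0 : ∀ᵐ x ∂(volume.restrict Ω), φ x 0 = 0) :
    luxemburgNorm Ω φ (fun _ => (0 : F)) = 0 := by
  refine le_antisymm (ENNReal.le_of_forall_pos_le_add fun ε hε _ => ?_) zero_le
  rw [zero_add]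
  refine iInf₂_le ε ⟨hε, ?_⟩
  rw [lintegral_eq_zero_of_ae_eq_zero]
  · exact zero_le_one
  · filter_upwards [h0] with x hx
    simpa using hx

/-- The modulars are summable, so by Tonelli the integrands are summable at a.e. point; hence they
tend to zero there, without passing to a subsequence. -/
theorem ae_tendsto_of_modular_le (hm : ∀ s : ℝ≥0, AEMeasurable (fun x => φ x s) (volume.restrict Ω))
    {β : ℝ≥0} {C : ℝ≥0 → ℝ≥0} (hφ : ∀ᵐ x ∂(volume.restrict Ω), DoublingPhi β C (φ x))
    {u : ℕ → E n → F} {g : E n → F} (hu : ∀ j, AEStronglyMeasurable (u j) (volume.restrict Ω))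
    (hg : AEStronglyMeasurable g (volume.restrict Ω))
    (h : ∀ j, modular Ω φ (fun x => u j x - g x) ≤ 2⁻¹ ^ j) : ModularTendsto Ω φ u g := by
  have hsum : ∑' j, modular Ω φ (fun x => u j x - g x) ≠ ∞ := by
    refine ne_top_of_le_ne_top ?_ (ENNReal.tsum_le_tsum h)
    rw [ENNReal.tsum_geometric]
    norm_num
  refine ⟨?_, ENNReal.tendsto_atTop_zero_of_tsum_ne_top hsum⟩
  have hmeas : ∀ j, AEMeasurable (fun x => φ x ‖u j x - g x‖₊) (volume.restrict Ω) := fun j =>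
    aemeasurable_phi hm hφ ((hu j).sub hg).nnnorm.aemeasurable
  have h1 : ∫⁻ x in Ω, ∑' j, φ x ‖u j x - g x‖₊ ≠ ∞ := by
    rw [lintegral_tsum hmeas]
    exact hsum
  filter_upwards [hφ, ae_lt_top' (AEMeasurable.tsum hmeas) h1] with x hx hfin
  have h2 := hx.tendsto_zero (ENNReal.tendsto_atTop_zero_of_tsum_ne_top hfin.ne)
  rw [tendsto_iff_norm_sub_tendsto_zero]
  simpa using (NNReal.tendsto_coe.2 h2)

end Modular

/-! ### Test functions -/

section TestFunction

variable {n : ℕ} {Ω : Set (E n)} {φ : E n → ℝ≥0 → ℝ≥0∞}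

theorem norm_gradient_eq (f : E n → ℝ) (x : E n) : ‖gradient f x‖ = ‖fderiv ℝ f x‖ := by
  simp [gradient]

theorem continuous_gradient {f : E n → ℝ} (hf : ContDiff ℝ 1 f) : Continuous (gradient f) :=
  (InnerProductSpace.toDual ℝ (E n)).symm.continuous.comp (hf.continuous_fderiv one_ne_zero)

theorem gradient_fun_sub {f g : E n → ℝ} {x : E n} (hf : DifferentiableAt ℝ f x)
    (hg : DifferentiableAt ℝ g x) :
    gradient (fun y => f y - g y) x = gradient f x - gradient g x := by
  simp only [gradient]
  rw [fderiv_fun_sub hf hg, map_sub]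

theorem gradient_fun_mul {f g : E n → ℝ} {x : E n} (hf : DifferentiableAt ℝ f x)
    (hg : DifferentiableAt ℝ g x) :
    gradient (fun y => f y * g y) x = f x • gradient g x + g x • gradient f x := by
  simp only [gradient]
  rw [fderiv_fun_mul hf hg]
  simp

theorem norm_gradient_sum_le {ι : Type*} (s : Finset ι) {f : ι → E n → ℝ} {x : E n}
    (hf : ∀ i ∈ s, DifferentiableAt ℝ (f i) x) :
    ‖gradient (fun y => ∑ i ∈ s, f i y) x‖ ≤ ∑ i ∈ s, ‖gradient (f i) x‖ := by
  simp only [norm_gradient_eq]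
  rw [fderiv_fun_sum hf]
  exact norm_sum_le _ _

theorem norm_gradient_comp_le {ψ : ℝ → ℝ} {L : ℝ≥0} (hψ : Differentiable ℝ ψ)
    (hL : LipschitzWith L ψ) {f : E n → ℝ} {x : E n} (hf : DifferentiableAt ℝ f x) :
    ‖gradient (fun y => ψ (f y)) x‖ ≤ L * ‖gradient f x‖ := by
  rw [norm_gradient_eq, norm_gradient_eq]
  have h1 := ((hψ (f x)).hasDerivAt.comp_hasFDerivAt x hf.hasFDerivAt).fderiv
  rw [show (fun y => ψ (f y)) = ψ ∘ f from rfl, h1, norm_smul]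
  gcongr
  exact norm_deriv_le_of_lipschitz hL

namespace IsTestFunction

variable {U V : Set (E n)} {η ζ : E n → ℝ}

theorem contDiff_one (h : IsTestFunction U η) : ContDiff ℝ 1 η :=
  h.smooth.of_le (by exact_mod_cast le_top)

theorem differentiable (h : IsTestFunction U η) : Differentiable ℝ η :=
  h.contDiff_one.differentiable one_ne_zero

theorem continuous (h : IsTestFunction U η) : Continuous η := h.smooth.continuous

theorem mono (h : IsTestFunction U η) (hUV : U ⊆ V) : IsTestFunction V η :=
  ⟨h.smooth, h.compactSupport, h.support_subset.trans hUV⟩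

theorem of_subset (h : IsTestFunction U η) (hζ : ContDiff ℝ ((⊤ : ℕ∞) : WithTop ℕ∞) ζ)
    (hs : Function.support ζ ⊆ tsupport η) : IsTestFunction U ζ :=
  ⟨hζ, h.compactSupport.mono' hs,
    (closure_minimal hs (isClosed_tsupport η)).trans h.support_subset⟩

theorem sub (h : IsTestFunction U η) (h' : IsTestFunction U ζ) :
    IsTestFunction U (fun x => η x - ζ x) where
  smooth := h.smooth.sub h'.smooth
  compactSupport := h.compactSupport.sub h'.compactSupport
  support_subset := (tsupport_sub η ζ).trans (union_subset h.support_subset h'.support_subset)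

theorem add (h : IsTestFunction U η) (h' : IsTestFunction U ζ) :
    IsTestFunction U (fun x => η x + ζ x) where
  smooth := h.smooth.add h'.smooth
  compactSupport := h.compactSupport.add h'.compactSupport
  support_subset := (tsupport_add η ζ).trans (union_subset h.support_subset h'.support_subset)

theorem zero : IsTestFunction U (fun _ => (0 : ℝ)) where
  smooth := contDiff_const
  compactSupport := HasCompactSupport.zero
  support_subset := by
    rw [show tsupport (fun _ : E n => (0 : ℝ)) = ∅ from tsupport_eq_empty_iff.2 rfl]
    exact empty_subset _

theorem sum {f : ℕ → E n → ℝ} (h : ∀ j, IsTestFunction U (f j)) (N : ℕ) :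
    IsTestFunction U (fun x => ∑ j ∈ Finset.range N, f j x) := by
  induction N with
  | zero => simpa using zero
  | succ k ih => simpa only [Finset.sum_range_succ] using ih.add (h k)

theorem exists_bound (h : IsTestFunction U η) :
    ∃ T : ℝ≥0, 0 < T ∧ (∀ x, ‖η x‖ ≤ T) ∧ ∀ x, ‖gradient η x‖ ≤ T := by
  obtain ⟨a, ha⟩ := h.compactSupport.exists_bound_of_continuous h.continuous
  obtain ⟨b, hb⟩ := (h.compactSupport.fderiv (𝕜 := ℝ)).exists_bound_of_continuous
    (h.contDiff_one.continuous_fderiv one_ne_zero)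
  have ha0 := (norm_nonneg _).trans (ha 0)
  have hb0 := (norm_nonneg _).trans (hb 0)
  refine ⟨Real.toNNReal (a + b + 1), Real.toNNReal_pos.2 (by positivity),
    fun x => (ha x).trans ?_, fun x => ?_⟩
  · rw [Real.coe_toNNReal _ (by positivity)]; linarith
  · rw [norm_gradient_eq, Real.coe_toNNReal _ (by positivity)]
    exact (hb x).trans (by linarith)

theorem setIntegral_eq (h : IsTestFunction Ω η) {f : E n → ℝ} (hf : ∀ x, η x = 0 → f x = 0) :
    ∫ x in Ω, f x = ∫ x, f x :=
  setIntegral_eq_integral_of_forall_compl_eq_zero fun x hx => hf x (by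
    by_contra h0
    exact hx (h.support_subset (subset_tsupport _ h0)))

theorem isSobolev (hΩb : Bornology.IsBounded Ω) {β : ℝ≥0} {C : ℝ≥0 → ℝ≥0} (hβ : 0 < β)
    (hφ : ∀ᵐ x ∂(volume.restrict Ω), DoublingPhi β C (φ x)) (h : IsTestFunction Ω η) :
    IsSobolev Ω φ η (gradient η) := by
  obtain ⟨T, -, hT, hT'⟩ := h.exists_bound
  have hsg : HasCompactSupport (gradient η) :=
    (h.compactSupport.fderiv (𝕜 := ℝ)).comp_left (map_zero (InnerProductSpace.toDual ℝ (E n)).symm)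
  refine ⟨(h.continuous.integrable_of_hasCompactSupport h.compactSupport).integrableOn,
    ((continuous_gradient h.contDiff_one).integrable_of_hasCompactSupport hsg).integrableOn,
    fun ζ hζ v => ?_, modular_lt_top_of_bounded hΩb hβ hφ hT,
    modular_lt_top_of_bounded hΩb hβ hφ hT'⟩
  rw [h.setIntegral_eq fun x hx => by simp [hx], hζ.setIntegral_eq fun x hx => by simp [hx]]
  simp only [inner_gradient_left]
  have c1 : Continuous fun x => fderiv ℝ η x v :=
    (h.contDiff_one.continuous_fderiv one_ne_zero).clm_apply continuous_const
  have c2 : Continuous fun x => fderiv ℝ ζ x v :=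
    (hζ.contDiff_one.continuous_fderiv one_ne_zero).clm_apply continuous_const
  refine integral_mul_fderiv_eq_neg_fderiv_mul_of_integrable ?_ ?_ ?_
    (fun x _ => h.differentiable x) (fun x _ => hζ.differentiable x)
  · exact (c1.mul hζ.continuous).integrable_of_hasCompactSupport hζ.compactSupport.mul_left
  · exact (h.continuous.mul c2).integrable_of_hasCompactSupport h.compactSupport.mul_right
  · exact (h.continuous.mul hζ.continuous).integrable_of_hasCompactSupport
      h.compactSupport.mul_right

theorem isSobolevZero (hΩb : Bornology.IsBounded Ω) {β : ℝ≥0} {C : ℝ≥0 → ℝ≥0} (hβ : 0 < β)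
    (hφ : ∀ᵐ x ∂(volume.restrict Ω), DoublingPhi β C (φ x)) (h : IsTestFunction Ω η) :
    IsSobolevZero Ω φ η (gradient η) := by
  refine ⟨h.isSobolev hΩb hβ hφ, fun ε hε => ⟨η, h, ?_⟩⟩
  simpa [luxemburgNorm_zero (hφ.mono fun x hx => hx.zero)] using hε

theorem isAdmissible (hΩb : Bornology.IsBounded Ω) {β : ℝ≥0} {C : ℝ≥0 → ℝ≥0} (hβ : 0 < β)
    (hφ : ∀ᵐ x ∂(volume.restrict Ω), DoublingPhi β C (φ x)) (h : IsTestFunction Ω η)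
    {K : Set (E n)} (hK : ∀ x ∈ K, 1 ≤ η x) : IsAdmissible Ω φ K η (gradient η) :=
  ⟨h.isSobolev hΩb hβ hφ, h.continuous, h.compactSupport, h.support_subset, hK⟩

end IsTestFunction

/-- The open set `V` matters: being `1` only on `K` would give neither a neighbourhood for the
capacity nor derivative identities at points of `K`. -/
theorem exists_testFunction_eq_one {K : Set (E n)} (hK : IsCompact K) (hΩ : IsOpen Ω)
    (hKΩ : K ⊆ Ω) :
    ∃ (η : E n → ℝ) (V : Set (E n)), IsTestFunction Ω η ∧ IsOpen V ∧ K ⊆ V ∧ V ⊆ Ω ∧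
      (∀ x ∈ V, η x = 1) ∧ ∀ x, η x ∈ Icc (0 : ℝ) 1 := by
  obtain ⟨L, hL, hKL, hLΩ⟩ := exists_compact_between hK hΩ hKΩ
  obtain ⟨L', hL', hLL', hL'Ω⟩ := exists_compact_between hL hΩ hLΩ
  obtain ⟨f, hf, hfr, hfs, hf1⟩ := exists_contMDiff_support_eq_eq_one_iff
    (modelWithCornersSelf ℝ (E n)) (n := ⊤) isOpen_interior hL.isClosed hLL'
  have hts : tsupport f ⊆ L' := by
    rw [tsupport, hfs]
    exact closure_minimal interior_subset hL'.isClosed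
  refine ⟨f, interior L, ⟨hf.contDiff, hL'.of_isClosed_subset (isClosed_tsupport f) hts,
    hts.trans hL'Ω⟩, isOpen_interior, hKL, interior_subset.trans hLΩ,
    fun x hx => (hf1 x).1 (interior_subset hx), fun x => hfr ⟨x, rfl⟩⟩

end TestFunction

/-! ### Removable sets have zero capacity -/

section Forward

variable {n : ℕ} {Ω : Set (E n)} {φ : E n → ℝ≥0 → ℝ≥0∞}

/-- A smooth nonnegative bounded truncation fixing `0` and `1`. -/
noncomputable def squareTrunc (t : ℝ) : ℝ := 2 * t ^ 2 / (1 + t ^ 2)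

theorem contDiff_squareTrunc : ContDiff ℝ ((⊤ : ℕ∞) : WithTop ℕ∞) squareTrunc := by
  unfold squareTrunc
  exact ContDiff.div (by fun_prop) (by fun_prop) fun x => by positivity

theorem lipschitzWith_squareTrunc : LipschitzWith 2 squareTrunc := by
  refine lipschitzWith_of_nnnorm_deriv_le
    (contDiff_squareTrunc.differentiable (by simp)) fun t => ?_
  have h1 : HasDerivAt squareTrunc
      ((2 * (2 * t) * (1 + t ^ 2) - 2 * t ^ 2 * (2 * t)) / (1 + t ^ 2) ^ 2) t := by
    have ha : HasDerivAt (fun t : ℝ => 2 * t ^ 2) (2 * (2 * t)) t := by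
      simpa using (hasDerivAt_pow 2 t).const_mul (2 : ℝ)
    have hb : HasDerivAt (fun t : ℝ => 1 + t ^ 2) (2 * t) t := by
      simpa using (hasDerivAt_pow 2 t).const_add (1 : ℝ)
    exact ha.div hb (by positivity)
  rw [h1.deriv, ← NNReal.coe_le_coe, coe_nnnorm, Real.norm_eq_abs, abs_le]
  have hpos : 0 < (1 + t ^ 2) ^ 2 := by positivity
  push_cast
  rw [le_div_iff₀ hpos, div_le_iff₀ hpos]
  constructor <;> nlinarith [sq_nonneg (t - 1), sq_nonneg (t + 1), sq_nonneg t, sq_nonneg (t ^ 2)]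

/-- On `V \ tsupport u` one has `η = 1` and `u = 0`, and this open set contains `K ∩ A`. Composing
with `squareTrunc` makes the function nonnegative, so that sums of such functions remain at least
`1`; the price is the Lipschitz factor `2`. -/
theorem exists_capacity_test_near (hΩ : IsOpen Ω) (hΩb : Bornology.IsBounded Ω) {β : ℝ≥0}
    {C : ℝ≥0 → ℝ≥0} (hβ : 0 < β)
    (hφ : ∀ᵐ x ∂(volume.restrict Ω), DoublingPhi β C (φ x)) {A K : Set (E n)}
    (h : SobolevZeroEqDiff Ω φ A) (hK : IsCompact K) (hKΩ : K ⊆ Ω) {ε : ℝ≥0∞} (hε : 0 < ε) :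
    ∃ (η : E n → ℝ) (U : Set (E n)), IsTestFunction Ω η ∧ IsOpen U ∧ K ∩ A ⊆ U ∧ U ⊆ Ω ∧
      (∀ x, 0 ≤ η x) ∧ (∀ x ∈ U, η x = 1) ∧ modular Ω φ (gradient η) < ε := by
  obtain ⟨η, V, hη, hV, hKV, hVΩ, hη1, -⟩ := exists_testFunction_eq_one hK hΩ hKΩ
  obtain ⟨u, hu, -, -, hlim⟩ := h η _ (hη.isSobolevZero hΩb hβ hφ)
  have hlim2 : Tendsto (fun j => (C 2 : ℝ≥0∞) * modular Ω φ (fun x => gradient (u j) x - gradient η x))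
      atTop (𝓝 0) := by
    simpa using ENNReal.Tendsto.const_mul (a := (C 2 : ℝ≥0∞)) hlim (Or.inr ENNReal.coe_ne_top)
  obtain ⟨j, hj⟩ := (hlim2.eventually (gt_mem_nhds hε)).exists
  have huΩ := (hu j).mono (sdiff_subset : Ω \ A ⊆ Ω)
  have hg := hη.sub huΩ
  refine ⟨fun x => squareTrunc (η x - u j x), V \ tsupport (u j),
    hg.of_subset (contDiff_squareTrunc.comp hg.smooth) ?_, hV.sdiff (isClosed_tsupport _),
    fun x hx => ⟨hKV hx.1, fun hxu => ((hu j).support_subset hxu).2 hx.2⟩,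
    sdiff_subset.trans hVΩ, fun x => by unfold squareTrunc; positivity, fun x hx => ?_, ?_⟩
  · refine Function.support_subset_iff'.2 fun x hx => ?_
    simp [image_eq_zero_of_notMem_tsupport hx, squareTrunc]
  · beta_reduce
    rw [hη1 x hx.1, image_eq_zero_of_notMem_tsupport hx.2]
    norm_num [squareTrunc]
  · refine (modular_le_mul hφ 2 fun x => ?_).trans_lt hj
    refine (norm_gradient_comp_le (contDiff_squareTrunc.differentiable (by simp))
      lipschitzWith_squareTrunc (hg.differentiable x)).trans ?_
    rw [gradient_fun_sub (hη.differentiable x) (huΩ.differentiable x), norm_sub_rev]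

theorem capacity_eq_zero_of_sobolevZeroEqDiff (hΩ : IsOpen Ω) (hΩb : Bornology.IsBounded Ω)
    (hm : ∀ s : ℝ≥0, AEMeasurable (fun x => φ x s) (volume.restrict Ω)) {β : ℝ≥0}
    {C : ℝ≥0 → ℝ≥0} (hβ : 0 < β)
    (hφ : ∀ᵐ x ∂(volume.restrict Ω), DoublingPhi β C (φ x)) {A : Set (E n)} (hA : A ⊆ Ω)
    (h : SobolevZeroEqDiff Ω φ A) : capacity Ω φ A = 0 := by
  refine le_antisymm (ENNReal.le_of_forall_pos_le_add fun ε hε _ => ?_) zero_le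
  rw [zero_add]
  obtain ⟨F, hFc, hFΩ, hFU, -⟩ := hΩ.exists_iUnion_isClosed
  have hF : ∀ j, IsCompact (F j) := fun j =>
    Metric.isCompact_of_isClosed_isBounded (hFc j) (hΩb.subset (hFΩ j))
  -- The piece `F j` receives the budget `δ j` after multiplication by the coefficient from
  -- `DoublingPhi.sum_le`, so the final bound is independent of the number of pieces a compact set
  -- needs.
  obtain ⟨δ, hδ0, hδ⟩ := ENNReal.exists_pos_sum_of_countable (ENNReal.coe_pos.2 hε).ne' ℕ
  have hex : ∀ j, ∃ (η : E n → ℝ) (U : Set (E n)), IsTestFunction Ω η ∧ IsOpen U ∧ F j ∩ A ⊆ U ∧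
      U ⊆ Ω ∧ (∀ x, 0 ≤ η x) ∧ (∀ x ∈ U, η x = 1) ∧
      C (2 ^ (j + 1)) * modular Ω φ (gradient η) ≤ δ j := by
    intro j
    obtain ⟨η, U, h1, h2, h3, h4, h5, h6, h7⟩ := exists_capacity_test_near hΩ hΩb hβ hφ h (hF j)
      (hFΩ j) (ε := (δ j : ℝ≥0∞) / (C (2 ^ (j + 1)) : ℝ≥0∞))
      (ENNReal.div_pos (ENNReal.coe_pos.2 (hδ0 j)).ne' ENNReal.coe_ne_top)
    refine ⟨η, U, h1, h2, h3, h4, h5, h6, ?_⟩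
    rw [mul_comm]
    exact ENNReal.mul_le_of_le_div h7.le
  choose η U hη hUo hAU hUΩ hη0 hη1 hle using hex
  have hAc : A ⊆ ⋃ j, U j := by
    intro x hx
    have hxΩ := hA hx
    rw [← hFU] at hxΩ
    obtain ⟨j, hj⟩ := mem_iUnion.1 hxΩ
    exact mem_iUnion.2 ⟨j, hAU j ⟨hj, hx⟩⟩
  refine (iInf₂_le (⋃ j, U j) ⟨isOpen_iUnion hUo, hAc, iUnion_subset hUΩ⟩).trans ?_
  refine iSup₂_le fun K hK => ?_
  obtain ⟨t, ht⟩ := hK.1.elim_finite_subcover U hUo hK.2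
  obtain ⟨N, hN⟩ := t.exists_nat_subset_range
  have hsum := IsTestFunction.sum hη N
  refine (iInf₂_le_of_le _ _ (iInf_le _ (hsum.isAdmissible hΩb hβ hφ fun x hx => ?_))).trans ?_
  · obtain ⟨i, hi, hxi⟩ := mem_iUnion₂.1 (ht hx)
    rw [← hη1 i x hxi]
    exact Finset.single_le_sum (f := fun j => η j x) (fun j _ => hη0 j x) (hN hi)
  calc modular Ω φ (gradient fun x => ∑ j ∈ Finset.range N, η j x)
      ≤ ∫⁻ x in Ω, ∑ j ∈ Finset.range N, C (2 ^ (j + 1)) * φ x ‖gradient (η j) x‖₊ := by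
        refine lintegral_mono_ae ?_
        filter_upwards [hφ] with x hx
        refine le_trans (hx.mono ?_) (hx.sum_le _ N)
        rw [← NNReal.coe_le_coe]
        push_cast
        exact norm_gradient_sum_le _ fun j _ => (hη j).differentiable x
    _ = ∑ j ∈ Finset.range N, C (2 ^ (j + 1)) * modular Ω φ (gradient (η j)) := by
        rw [lintegral_finsetSum']
        · simp only [lintegral_const_mul' _ _ ENNReal.coe_ne_top, modular]
        · exact fun j _ => (aemeasurable_phi hm hφ
            (continuous_gradient (hη j).contDiff_one).nnnorm.measurable.aemeasurable).const_mul _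
    _ ≤ ∑ j ∈ Finset.range N, (δ j : ℝ≥0∞) := Finset.sum_le_sum fun j _ => hle j
    _ ≤ ∑' j, (δ j : ℝ≥0∞) := ENNReal.sum_le_tsum _
    _ ≤ ε := hδ.le

end Forward

/-! ### Mollification -/

section Mollify

variable {n : ℕ} {Ω : Set (E n)} {φ : E n → ℝ≥0 → ℝ≥0∞}

/-- A probability density supported in the ball of radius `δ` about the origin and bounded by
a multiple `K` of the uniform density on that ball. -/
structure IsMollifier (δ : ℝ) (K : ℝ≥0) (ρ : E n → ℝ≥0∞) : Prop where
  measurable : Measurable ρ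
  lintegral_eq_one : ∫⁻ x, ρ x = 1
  eq_zero : ∀ x, x ∉ Metric.ball 0 δ → ρ x = 0
  le_div : ∀ x, ρ x ≤ K / volume (Metric.ball (0 : E n) δ)

/-- The convolution of the kernel `ρ` with the restriction of `h` to `Ω`. -/
noncomputable def mollify (Ω : Set (E n)) (ρ : E n → ℝ≥0∞) (h : E n → ℝ≥0∞) (x : E n) : ℝ≥0∞ :=
  ∫⁻ y in Ω, ρ (x - y) * h y

variable {δ : ℝ} {K : ℝ≥0} {ρ : E n → ℝ≥0∞}

theorem IsMollifier.aemeasurable_prod (hρ : IsMollifier δ K ρ) {h : E n → ℝ≥0∞} (μ : Measure (E n))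
    [SFinite μ] (hh : AEMeasurable h (volume.restrict Ω)) :
    AEMeasurable (Function.uncurry fun x y => ρ (x - y) * h y)
      (μ.prod (volume.restrict Ω)) :=
  (hρ.measurable.comp (measurable_fst.sub measurable_snd)).aemeasurable.mul hh.comp_snd

theorem IsMollifier.aemeasurable_mollify (hρ : IsMollifier δ K ρ) {h : E n → ℝ≥0∞}
    (μ : Measure (E n)) [SFinite μ] (hh : AEMeasurable h (volume.restrict Ω)) :
    AEMeasurable (mollify Ω ρ h) μ :=
  (hρ.aemeasurable_prod μ hh).lintegral_prod_right'

theorem IsMollifier.lintegral_mollify (hρ : IsMollifier δ K ρ) {h : E n → ℝ≥0∞}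
    (hh : AEMeasurable h (volume.restrict Ω)) :
    ∫⁻ x, mollify Ω ρ h x = ∫⁻ y in Ω, h y := by
  unfold mollify
  rw [lintegral_lintegral_swap (hρ.aemeasurable_prod volume hh)]
  refine lintegral_congr fun y => ?_
  have hm : Measurable fun x => ρ (x - y) := hρ.measurable.comp (measurable_id.sub_const y)
  rw [lintegral_mul_const _ hm, lintegral_sub_right_eq_self, hρ.lintegral_eq_one, one_mul]

theorem IsMollifier.mollify_le (hρ : IsMollifier δ K ρ) (h : E n → ℝ≥0∞) (x : E n) :
    mollify Ω ρ h x ≤ K / volume (Metric.ball (0 : E n) δ) * ∫⁻ y in Ω, h y := by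
  -- The quotient is infinite only if the ball is null, that is `δ ≤ 0`; then the ball is empty and
  -- `ρ` vanishes.
  by_cases hK : (K / volume (Metric.ball (0 : E n) δ) : ℝ≥0∞) = ∞
  · rcases eq_or_ne (∫⁻ y in Ω, h y) 0 with h0 | h0
    · by_cases hδ : 0 < δ
      · exact absurd hK (ENNReal.div_ne_top ENNReal.coe_ne_top
          (Metric.measure_ball_pos _ _ hδ).ne')
      · have : ∀ z, ρ z = 0 := fun z => hρ.eq_zero z (by
          rw [Metric.ball_eq_empty.2 (not_lt.1 hδ)]; exact notMem_empty z)
        simp [mollify, this]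
    · rw [hK, ENNReal.top_mul h0]; exact le_top
  rw [← lintegral_const_mul' _ _ hK]
  exact lintegral_mono fun y => mul_le_mul_left (hρ.le_div _) _

theorem IsMollifier.mollify_const_le (hρ : IsMollifier δ K ρ) (c : ℝ≥0∞) (x : E n) :
    mollify Ω ρ (fun _ => c) x ≤ c := by
  have hm : Measurable fun y => ρ (x - y) := hρ.measurable.comp (measurable_const.sub measurable_id)
  unfold mollify
  rw [lintegral_mul_const _ hm]
  calc (∫⁻ y in Ω, ρ (x - y)) * c ≤ (∫⁻ y, ρ (x - y)) * c := by
        gcongr; exact Measure.restrict_le_self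
    _ = c := by rw [lintegral_sub_left_eq_self, hρ.lintegral_eq_one, one_mul]

theorem mollify_ne_top (hρ : IsMollifier δ K ρ) (hδ : 0 < δ) {h : E n → ℝ≥0∞}
    (hh : ∫⁻ y in Ω, h y ≠ ∞) (x : E n) : mollify Ω ρ h x ≠ ∞ :=
  ne_top_of_le_ne_top (ENNReal.mul_ne_top (ENNReal.div_ne_top ENNReal.coe_ne_top
    (Metric.measure_ball_pos _ _ hδ).ne') hh) (hρ.mollify_le h x)

variable {β : ℝ≥0} {C : ℝ≥0 → ℝ≥0}

/-- A form of Jensen's inequality for the infimum of `φ` over a ball. -/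
theorem phiInf_le_mollify (hΩ : IsOpen Ω) (hβ : 0 < β)
    (hφ : ∀ᵐ x ∂(volume.restrict Ω), DoublingPhi β C (φ x)) (hρ : IsMollifier δ K ρ) (hδ : 0 < δ)
    {g : E n → ℝ≥0} {x : E n} (hx : x ∈ Ω)
    (hxφ : DoublingPhi β C (φ x)) {t : ℝ≥0} (ht : 0 < t)
    (htM : 2 * (t : ℝ≥0∞) ≤ mollify Ω ρ (fun y => g y) x) :
    phiInf Ω φ (Metric.ball x δ) t ≤ mollify Ω ρ (fun y => φ y (g y)) x := by
  set P := phiInf Ω φ (Metric.ball x δ) t with hP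
  have hPtop : P ≠ ∞ := ne_top_of_le_ne_top (hxφ.ne_top hβ t)
    (iInf₂_le (f := fun y (_ : y ∈ Metric.ball x δ ∩ Ω) => φ y t) x
      ⟨Metric.mem_ball_self hδ, hx⟩)
  have hmρ : Measurable fun y => ρ (x - y) :=
    hρ.measurable.comp (measurable_const.sub measurable_id)
  -- An infimum of convex functions need not be convex, so only the monotonicity of `s ↦ φ y s / s`
  -- is used: `g y * P` is at most `t * P` if `g y ≤ t`, and at most `t * φ y (g y)` otherwise. The
  -- factor `2` in `htM` then absorbs the term `t * P`.
  have h1 : mollify Ω ρ (fun y => g y) x * P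
      ≤ mollify Ω ρ (fun _ => t * P) x + t * mollify Ω ρ (fun y => φ y (g y)) x := by
    unfold mollify
    rw [← lintegral_const_mul' _ _ ENNReal.coe_ne_top, ← lintegral_mul_const' _ _ hPtop,
      ← lintegral_add_left (hmρ.mul_const _)]
    refine lintegral_mono_ae ?_
    filter_upwards [hφ, ae_restrict_mem hΩ.measurableSet] with y hy hyΩ
    by_cases hyB : y ∈ Metric.ball x δ
    · have hPy : P ≤ φ y t := iInf₂_le (f := fun y (_ : y ∈ Metric.ball x δ ∩ Ω) => φ y t) y
        ⟨hyB, hyΩ⟩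
      have h2 : (g y : ℝ≥0∞) * P ≤ t * P + t * φ y (g y) := by
        rcases le_total (g y) t with hgt | hgt
        · exact le_trans (by gcongr) le_self_add
        · exact le_trans (le_trans (by gcongr) (hy.mul_le_mul hgt)) le_add_self
      calc ρ (x - y) * g y * P = ρ (x - y) * (g y * P) := by ring
        _ ≤ ρ (x - y) * (t * P + t * φ y (g y)) := by gcongr
        _ = _ := by ring
    · rw [hρ.eq_zero (x - y) (by
        rw [mem_ball_zero_iff, ← dist_eq_norm, dist_comm]; exact hyB)]
      simp
  have h2 : (t : ℝ≥0∞) * P + t * P ≤ t * P + t * mollify Ω ρ (fun y => φ y (g y)) x := by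
    calc (t : ℝ≥0∞) * P + t * P = 2 * (t : ℝ≥0∞) * P := by ring
      _ ≤ mollify Ω ρ (fun y => g y) x * P := by gcongr
      _ ≤ _ := h1.trans (by gcongr; exact hρ.mollify_const_le _ _)
  have h3 := (ENNReal.add_le_add_iff_left (ENNReal.mul_ne_top ENNReal.coe_ne_top hPtop)).1 h2
  exact (ENNReal.mul_le_mul_iff_right (ENNReal.coe_pos.2 ht).ne' ENNReal.coe_ne_top).1 h3

/-- For averages up to `2` convexity gives a linear bound. For larger ones, Jensen bounds the
infimum over the ball at `N / 2` by the averaged `φ`, and (A1) passes from the infimum to `φ x`. The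
smallness assumption keeps the averaged `φ` below `1 / |B|`, which puts `N / 2` in the range of
(A1). `Q` depends on neither the radius nor the kernel. -/
theorem exists_phi_mollify_le (hΩ : IsOpen Ω) (hβ : 0 < β)
    (hφ : ∀ᵐ x ∂(volume.restrict Ω), DoublingPhi β C (φ x)) (hA1 : CondA1 Ω φ) :
    ∃ Q : ℝ≥0, ∀ (δ : ℝ) (K : ℝ≥0) (ρ : E n → ℝ≥0∞), 0 < δ → IsMollifier δ K ρ →
      ∀ g : E n → ℝ≥0, AEMeasurable g (volume.restrict Ω) →
      K * ∫⁻ y in Ω, φ y (g y) < 1 → ∀ᵐ x ∂(volume.restrict Ω), ∀ N : ℝ≥0,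
      mollify Ω ρ (fun y => g y) x = N →
      φ x N ≤ Q * mollify Ω ρ (fun y => g y) x
        + Q * mollify Ω ρ (fun y => φ y (g y)) x := by
  obtain ⟨β₁, hβ₁, -, hA⟩ := hA1
  -- The first summand is the slope on `[0, 2]`; the second is the doubling cost from `β₁ * (N / 2)`
  -- to `N`.
  refine ⟨C (2 / β) / 2 + C (2 / β₁), fun δ K ρ hδ hρ g hg hsmall => ?_⟩
  filter_upwards [hφ, ae_restrict_mem hΩ.measurableSet] with x hx hxΩ N hN
  rcases le_total N 2 with hN2 | hN2
  · refine le_trans ?_ le_self_add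
    rw [hN]
    refine (hx.le_linear hβ two_pos hN2).trans ?_
    gcongr
    exact le_self_add
  refine le_trans ?_ le_add_self
  set R := mollify Ω ρ (fun y => φ y (g y)) x with hR
  set B := Metric.ball x δ with hB
  have hs1 : 1 ≤ N / 2 := by rwa [le_div_iff₀ two_pos, one_mul]
  have key : ∀ t : ℝ≥0, 0 < t → t ≤ N / 2 → phiInf Ω φ B t ≤ R := fun t ht htN => by
    refine phiInf_le_mollify hΩ hβ hφ hρ hδ hxΩ hx ht ?_
    rw [hN]
    exact_mod_cast (by rwa [le_div_iff₀ two_pos, mul_comm] at htN : 2 * t ≤ N)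
  have hvol0 : volume (Metric.ball (0 : E n) δ) ≠ 0 := (Metric.measure_ball_pos _ _ hδ).ne'
  have hvolt : volume (Metric.ball (0 : E n) δ) ≠ ∞ := measure_ball_lt_top.ne
  have hvol : volume B = volume (Metric.ball (0 : E n) δ) := Measure.addHaar_ball_center _ _ _
  have hRlt : R < (volume B)⁻¹ := by
    refine (hρ.mollify_le _ x).trans_lt ?_
    rw [hvol, div_eq_mul_inv, mul_right_comm]
    calc _ < 1 * (volume (Metric.ball (0 : E n) δ))⁻¹ :=
          ENNReal.mul_lt_mul_left (ENNReal.inv_ne_zero.2 hvolt) (ENNReal.inv_ne_top.2 hvol0) hsmall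
      _ = _ := one_mul _
  -- A point `t < N / 2` at which the infimum reaches `1 / |B|` would contradict `key` and `hRlt`;
  -- `t = 0` is separate because `key` needs `t > 0`.
  have hinv : ((N / 2 : ℝ≥0) : ℝ≥0∞) ≤ leftInv (phiInf Ω φ B) (volume B)⁻¹ := by
    refine le_iInf₂ fun t ht => ?_
    by_contra! hlt
    have htN : t ≤ N / 2 := by exact_mod_cast hlt.le
    rcases eq_or_ne t 0 with rfl | ht0
    · have : phiInf Ω φ B 0 ≤ 0 := by
        rw [← hx.zero]
        exact iInf₂_le (f := fun y (_ : y ∈ B ∩ Ω) => φ y 0) x ⟨Metric.mem_ball_self hδ, hxΩ⟩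
      exact absurd (ht.trans this) (not_le.2 (ENNReal.inv_pos.2 (hvol ▸ hvolt)))
    · exact absurd (ht.trans (key t (pos_iff_ne_zero.2 ht0) htN)) (not_le.2 hRlt)
  have h1 := hA x δ hδ (le_trans (by exact_mod_cast hs1) hinv) (N / 2) hs1 hinv
  have h2 : φ x (β₁ * (N / 2)) ≤ R :=
    ((le_iSup₂ (f := fun y (_ : y ∈ B ∩ Ω) => φ y (β₁ * (N / 2))) x
      ⟨Metric.mem_ball_self hδ, hxΩ⟩).trans h1).trans (key _ (one_pos.trans_le hs1) le_rfl)
  have h3 := hx.doubling (2 / β₁) (β₁ * (N / 2))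
  rw [show 2 / β₁ * (β₁ * (N / 2)) = N by field_simp] at h3
  refine h3.trans ?_
  gcongr
  exact le_add_self

/-- The pointwise estimate is integrated; mollification preserves integrals by Tonelli. -/
theorem exists_modular_le_of_le_mollify (hΩ : IsOpen Ω)
    (hm : ∀ s : ℝ≥0, AEMeasurable (fun x => φ x s) (volume.restrict Ω)) (hβ : 0 < β)
    (hφ : ∀ᵐ x ∂(volume.restrict Ω), DoublingPhi β C (φ x)) (hA1 : CondA1 Ω φ) :
    ∃ Q : ℝ≥0, ∀ (δ : ℝ) (K : ℝ≥0) (ρ : E n → ℝ≥0∞), 0 < δ → IsMollifier δ K ρ →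
      ∀ G H : E n → E n, IntegrableOn G Ω → K * modular Ω φ G < 1 →
      (∀ x, ‖H x‖ₑ ≤ mollify Ω ρ (fun y => ‖G y‖ₑ) x) →
      modular Ω φ H ≤ Q * (∫⁻ x in Ω, ‖G x‖ₑ) + Q * modular Ω φ G := by
  obtain ⟨Q, hQ⟩ := exists_phi_mollify_le hΩ hβ hφ hA1
  refine ⟨Q, fun δ K ρ hδ hρ G H hG hsmall hH => ?_⟩
  have hGm := hG.aestronglyMeasurable.nnnorm.aemeasurable
  have hGe : AEMeasurable (fun y => ‖G y‖ₑ) (volume.restrict Ω) := hG.aestronglyMeasurable.enorm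
  have hφG := aemeasurable_phi hm hφ hGm
  calc modular Ω φ H ≤ ∫⁻ x in Ω, (Q * mollify Ω ρ (fun y => ‖G y‖ₑ) x
        + Q * mollify Ω ρ (fun y => φ y ‖G y‖₊) x) := by
        refine lintegral_mono_ae ?_
        filter_upwards [hφ, hQ δ K ρ hδ hρ (fun y => ‖G y‖₊) hGm hsmall] with x hx hx2
        have hfin : mollify Ω ρ (fun y => ‖G y‖ₑ) x ≠ ∞ :=
          mollify_ne_top hρ hδ hG.hasFiniteIntegral.ne x
        refine le_trans (hx.mono ?_) (hx2 _ (ENNReal.coe_toNNReal hfin).symm)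
        exact ENNReal.coe_le_coe.1 ((hH x).trans (ENNReal.coe_toNNReal hfin).symm.le)
    _ = Q * (∫⁻ x in Ω, mollify Ω ρ (fun y => ‖G y‖ₑ) x)
        + Q * ∫⁻ x in Ω, mollify Ω ρ (fun y => φ y ‖G y‖₊) x := by
        rw [lintegral_add_left' ((hρ.aemeasurable_mollify _ hGe).const_mul _),
          lintegral_const_mul' _ _ ENNReal.coe_ne_top, lintegral_const_mul' _ _ ENNReal.coe_ne_top]
    _ ≤ _ := by
        refine add_le_add (mul_le_mul_right ?_ _) (mul_le_mul_right ?_ _)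
        · rw [← hρ.lintegral_mollify hGe]
          exact lintegral_mono' Measure.restrict_le_self le_rfl
        · rw [modular, ← hρ.lintegral_mollify hφG]
          exact lintegral_mono' Measure.restrict_le_self le_rfl

end Mollify

/-! ### Smoothing of admissible functions, truncation, and the Poincaré inequality -/

section SmoothApprox

variable {n : ℕ} {Ω : Set (E n)} {φ : E n → ℝ≥0 → ℝ≥0∞}

theorem isMollifier_normed (b : ContDiffBump (0 : E n)) (hb : b.rOut ≤ 2 * b.rIn) :
    IsMollifier b.rOut (2 ^ n) (fun x => ENNReal.ofReal (b.normed volume x)) where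
  measurable := (b.contDiff_normed (n := 0)).continuous.measurable.ennreal_ofReal
  lintegral_eq_one := by
    rw [← ofReal_integral_eq_lintegral_ofReal b.integrable_normed
      (Eventually.of_forall b.nonneg_normed), b.integral_normed, ENNReal.ofReal_one]
  eq_zero x hx := by
    rw [← b.support_normed_eq (μ := volume), Function.notMem_support] at hx
    rw [hx, ENNReal.ofReal_zero]
  le_div x := by
    have h := b.normed_le_div_measure_closedBall_rOut volume 2 hb x
    have hpos : 0 < volume.real (Metric.closedBall (0 : E n) b.rOut) :=
      ENNReal.toReal_pos (Metric.measure_closedBall_pos _ _ b.rOut_pos).ne'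
        measure_closedBall_lt_top.ne
    refine (ENNReal.ofReal_le_ofReal h).trans ?_
    rw [ENNReal.ofReal_div_of_pos hpos, measureReal_def,
      ENNReal.ofReal_toReal measure_closedBall_lt_top.ne,
      Measure.addHaar_closedBall _ _ b.rOut_pos.le, ← Measure.addHaar_ball_of_pos _ 0 b.rOut_pos,
      finrank_euclideanSpace_fin]
    gcongr
    rw [ENNReal.ofReal_pow zero_le_two]
    simp

-- The kernel `ρ (x - ·)` may leave `Ω`, so it is not a legitimate test function. Multiplying it by
-- a cutoff `χ` equal to `1` near `tsupport f` repairs this without changing the terms containing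
-- `f`. On the side of `G` the factor stays, harmless for upper bounds as `0 ≤ χ ≤ 1`.
open scoped Convolution in
theorem fderiv_normed_convolution (b : ContDiffBump (0 : E n)) {f : E n → ℝ} {G : E n → E n}
    (hΩ : IsOpen Ω) (hf : IsSobolev Ω φ f G) (hc : Continuous f) (hcs : HasCompactSupport f)
    (hfΩ : tsupport f ⊆ Ω) :
    ∃ χ : E n → ℝ, (∀ x, χ x ∈ Icc (0 : ℝ) 1) ∧ ∀ x v : E n,
      fderiv ℝ (b.normed volume ⋆[ContinuousLinearMap.lsmul ℝ ℝ, volume] f) x v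
        = ∫ y in Ω, inner ℝ (G y) v * (χ y * b.normed volume (x - y)) := by
  obtain ⟨χ, V, hχ, hV, hfV, -, hχ1, hχI⟩ := exists_testFunction_eq_one hcs hΩ hfΩ
  refine ⟨χ, hχI, fun x v => ?_⟩
  have hρ : ContDiff ℝ ((⊤ : ℕ∞) : WithTop ℕ∞) (b.normed (volume : Measure (E n))) :=
    b.contDiff_normed
  have hρ1 : ContDiff ℝ 1 (b.normed (volume : Measure (E n))) := b.contDiff_normed
  have hρd : Differentiable ℝ (b.normed (volume : Measure (E n))) :=
    hρ1.differentiable one_ne_zero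
  have hρs : HasCompactSupport (b.normed (volume : Measure (E n))) := b.hasCompactSupport_normed
  have hloc : LocallyIntegrable f (volume : Measure (E n)) := hc.locallyIntegrable
  have hη : IsTestFunction Ω fun y => χ y * b.normed volume (x - y) :=
    hχ.of_subset (hχ.smooth.mul (hρ.comp (contDiff_const.sub contDiff_id)))
      (fun y hy => subset_tsupport _ (left_ne_zero_of_mul hy))
  have h1 := hf.weak_grad _ hη v
  rw [eq_neg_iff_add_eq_zero, add_comm, ← eq_neg_iff_add_eq_zero] at h1
  rw [h1, (hρs.hasFDerivAt_convolution_left (ContinuousLinearMap.lsmul ℝ ℝ) hρ1 hloc x).fderiv]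
  have hex := (hρs.fderiv (𝕜 := ℝ)).convolutionExists_left
    ((ContinuousLinearMap.lsmul ℝ ℝ).precompL (E n)) (hρ1.continuous_fderiv one_ne_zero) hloc x
  rw [convolution_def, ContinuousLinearMap.integral_apply hex, ← integral_neg,
    setIntegral_eq_integral_of_forall_compl_eq_zero fun y hy => by
      rw [image_eq_zero_of_notMem_tsupport fun h => hy (hfΩ h), zero_mul, neg_zero],
    ← integral_sub_left_eq_self _ volume x]
  refine integral_congr_ae (Eventually.of_forall fun y => ?_)
  simp only [sub_sub_cancel]
  by_cases hy : y ∈ tsupport f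
  · have hd : fderiv ℝ (fun y => χ y * b.normed volume (x - y)) y
        = -fderiv ℝ (b.normed volume) (x - y) := by
      have heq : (fun y => χ y * b.normed volume (x - y)) =ᶠ[𝓝 y]
          fun y => b.normed volume (x - y) := by
        filter_upwards [hV.mem_nhds (hfV hy)] with z hz
        rw [hχ1 z hz, one_mul]
      rw [heq.fderiv_eq]
      refine ((hρd (x - y)).hasFDerivAt.comp y ((hasFDerivAt_id y).const_sub x)).fderiv.trans ?_
      ext; simp
    rw [hd]
    simp [mul_comm]
  · simp [image_eq_zero_of_notMem_tsupport hy]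

-- The radius comes from uniform continuity: `u` differs from `f` by at most `1/4`, so `u ≥ 1/2`
-- where `f > 3/4`. Capping it at `1` keeps all supports in one fixed bounded set, hence one
-- Poincaré constant.
open scoped Convolution in
theorem exists_smooth_capacity_test (hΩ : IsOpen Ω) {K : Set (E n)} {f : E n → ℝ}
    {G : E n → E n} (hf : IsAdmissible Ω φ K f G) :
    ∃ (u : E n → ℝ) (V : Set (E n)) (δ : ℝ) (ρ : E n → ℝ≥0∞), 0 < δ ∧ IsMollifier δ (2 ^ n) ρ ∧
      ContDiff ℝ ((⊤ : ℕ∞) : WithTop ℕ∞) u ∧ Function.support u ⊆ Metric.thickening 1 Ω ∧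
      IsOpen V ∧ K ⊆ V ∧ (∀ x ∈ V, 1 / 2 ≤ u x) ∧
      ∀ x, ‖gradient u x‖ₑ ≤ mollify Ω ρ (fun y => ‖G y‖ₑ) x := by
  obtain ⟨d, hd, hdf⟩ := Metric.uniformContinuous_iff.1
    (hf.compactSupport.uniformContinuous_of_continuous hf.continuous) (1 / 4) (by norm_num)
  have hδ : 0 < min d 1 := lt_min hd one_pos
  let b : ContDiffBump (0 : E n) := ⟨min d 1 / 2, min d 1, half_pos hδ, half_lt_self hδ⟩
  set u := b.normed volume ⋆[ContinuousLinearMap.lsmul ℝ ℝ, volume] f with hu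
  obtain ⟨χ, hχ, hfd⟩ := fderiv_normed_convolution b hΩ hf.isSobolev hf.continuous
    hf.compactSupport hf.support_subset
  refine ⟨u, {x | 3 / 4 < f x}, min d 1, fun x => ENNReal.ofReal (b.normed volume x), hδ,
    isMollifier_normed b (by change min d 1 ≤ 2 * (min d 1 / 2); linarith),
    b.hasCompactSupport_normed.contDiff_convolution_left _ b.contDiff_normed
      hf.continuous.locallyIntegrable, ?_, isOpen_lt continuous_const hf.continuous,
    fun x hx => lt_of_lt_of_le (by norm_num) (hf.one_le x hx), fun x hx => ?_, fun x => ?_⟩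
  · refine (support_convolution_subset _).trans ?_
    rintro _ ⟨t, ht, y, hy, rfl⟩
    rw [b.support_normed_eq, mem_ball_zero_iff] at ht
    rw [Metric.mem_thickening_iff]
    refine ⟨y, hf.support_subset (subset_tsupport _ hy), ?_⟩
    simpa using ht.trans_le (min_le_right d 1)
  · have h1 : dist (u x) (f x) ≤ 1 / 4 :=
      b.dist_normed_convolution_le hf.continuous.aestronglyMeasurable
        fun y hy => (hdf (lt_of_lt_of_le hy (min_le_left d 1))).le
    rw [Real.dist_eq, abs_le] at h1
    have hx' : 3 / 4 < f x := hx
    linarith [h1.1]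
  · set M := mollify Ω (fun x => ENNReal.ofReal (b.normed volume x)) (fun y => ‖G y‖ₑ) x with hM
    rcases eq_or_ne (gradient u x) 0 with h0 | h0
    · simp [h0]
    -- The derivative is tested in the direction of the gradient itself, and one factor is
    -- cancelled.
    have h1 : ‖gradient u x‖ₑ * ‖gradient u x‖ₑ ≤ ‖gradient u x‖ₑ * M := by
      calc ‖gradient u x‖ₑ * ‖gradient u x‖ₑ = ‖fderiv ℝ u x (gradient u x)‖ₑ := by
            rw [← inner_gradient_left, real_inner_self_eq_norm_mul_norm, enorm_mul, enorm_norm]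
        _ ≤ ∫⁻ y in Ω, ‖inner ℝ (G y) (gradient u x) * (χ y * b.normed volume (x - y))‖ₑ := by
            rw [hfd]
            exact enorm_integral_le_lintegral_enorm _
        _ ≤ ∫⁻ y in Ω, ‖gradient u x‖ₑ * (ENNReal.ofReal (b.normed volume (x - y)) * ‖G y‖ₑ) := by
            refine lintegral_mono fun y => ?_
            have hb0 := b.nonneg_normed (μ := volume) (x - y)
            rw [enorm_mul, enorm_mul, ← Real.enorm_of_nonneg hb0]
            have e1 : ‖inner ℝ (G y) (gradient u x)‖ₑ ≤ ‖G y‖ₑ * ‖gradient u x‖ₑ := by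
              simp only [enorm_eq_nnnorm, ← ENNReal.coe_mul]
              exact ENNReal.coe_le_coe.2 (nnnorm_inner_le_nnnorm (𝕜 := ℝ) (G y) (gradient u x))
            have e2 : ‖χ y‖ₑ ≤ 1 := by
              rw [Real.enorm_of_nonneg (hχ y).1]
              exact ENNReal.ofReal_le_one.2 (hχ y).2
            calc _ ≤ ‖G y‖ₑ * ‖gradient u x‖ₑ * (1 * ‖b.normed volume (x - y)‖ₑ) := by gcongr
              _ = _ := by ring
        _ = ‖gradient u x‖ₑ * M := by
            rw [lintegral_const_mul' _ _ enorm_ne_top, hM, mollify]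
    exact (ENNReal.mul_le_mul_iff_right (by simpa using h0) enorm_ne_top).1 h1

theorem exists_lipschitzWith_smoothTransition :
    ∃ L : ℝ≥0, LipschitzWith L Real.smoothTransition := by
  have hd : ContDiff ℝ 1 Real.smoothTransition := Real.smoothTransition.contDiff
  obtain ⟨B, hB⟩ := isCompact_Icc (a := (0 : ℝ)) (b := 1) |>.exists_bound_of_continuousOn
    (hd.continuous_deriv le_rfl).continuousOn
  have hB0 : 0 ≤ B := (norm_nonneg _).trans (hB 0 (by simp))
  refine ⟨B.toNNReal, lipschitzWith_of_nnnorm_deriv_le (hd.differentiable one_ne_zero)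
    fun x => ?_⟩
  rw [← NNReal.coe_le_coe, coe_nnnorm, Real.coe_toNNReal _ hB0]
  by_cases hx : x ∈ Icc (0 : ℝ) 1
  · exact hB x hx
  have : deriv Real.smoothTransition x = 0 := by
    rcases not_and_or.1 hx with h | h
    · have : Real.smoothTransition =ᶠ[𝓝 x] fun _ => 0 := by
        filter_upwards [Iio_mem_nhds (not_le.1 h)] with y hy
        exact Real.smoothTransition.zero_of_nonpos (le_of_lt hy)
      rw [this.deriv_eq, deriv_const]
    · have : Real.smoothTransition =ᶠ[𝓝 x] fun _ => 1 := by
        filter_upwards [Ioi_mem_nhds (not_le.1 h)] with y hy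
        exact Real.smoothTransition.one_of_one_le (le_of_lt hy)
      rw [this.deriv_eq, deriv_const]
  rw [this, norm_zero]
  exact hB0

/-- A smooth truncation to `[0, 1]` that vanishes for `t ≤ 0` and equals `1` for `t ≥ 1/2`. -/
theorem exists_smooth_truncation : ∃ (ψ : ℝ → ℝ) (L : ℝ≥0),
    ContDiff ℝ ((⊤ : ℕ∞) : WithTop ℕ∞) ψ ∧ LipschitzWith L ψ ∧ ψ 0 = 0 ∧
      (∀ t, 1 / 2 ≤ t → ψ t = 1) ∧ ∀ t, ψ t ∈ Icc (0 : ℝ) 1 := by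
  obtain ⟨L, hL⟩ := exists_lipschitzWith_smoothTransition
  refine ⟨fun t => Real.smoothTransition (2 * t), L * 2,
    Real.smoothTransition.contDiff.comp (contDiff_const.mul contDiff_id),
    hL.comp (LipschitzWith.of_dist_le_mul fun x y => ?_), by simp,
    fun t ht => Real.smoothTransition.one_of_one_le (by linarith),
    fun t => ⟨Real.smoothTransition.nonneg _, Real.smoothTransition.le_one _⟩⟩
  rw [Real.dist_eq, Real.dist_eq, ← mul_sub, abs_mul]
  simp

theorem exists_poincare (hn : 2 ≤ n) (hΩb : Bornology.IsBounded Ω) :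
    ∃ P : ℝ≥0, ∀ u : E n → ℝ, ContDiff ℝ 1 u → Function.support u ⊆ Metric.thickening 1 Ω →
      ∫⁻ x, ‖u x‖ₑ ≤ P * ∫⁻ x, ‖gradient u x‖ₑ := by
  refine ⟨eLpNormLESNormFDerivOfLeConst ℝ volume (Metric.thickening 1 Ω) 1 1,
    fun u hu hs => ?_⟩
  have h := eLpNorm_le_eLpNorm_fderiv_of_le (F := ℝ) (volume : Measure (E n)) hu hs (p := 1) (q := 1)
    le_rfl (by rw [finrank_euclideanSpace_fin]; exact_mod_cast hn) (by simp) hΩb.thickening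
  rw [ENNReal.coe_one, eLpNorm_one_eq_lintegral_enorm, eLpNorm_one_eq_lintegral_enorm] at h
  refine h.trans (le_of_eq ?_)
  congr 1
  refine lintegral_congr fun x => ?_
  rw [← enorm_norm, ← enorm_norm (gradient u x), norm_gradient_eq]

end SmoothApprox

/-! ### Sets of zero capacity are removable -/

section Backward

variable {n : ℕ} {Ω : Set (E n)} {φ : E n → ℝ≥0 → ℝ≥0∞} {β : ℝ≥0} {C : ℝ≥0 → ℝ≥0}

theorem exists_modular_bound_lintegral_le (hΩb : Bornology.IsBounded Ω)
    (hφ : ∀ᵐ x ∂(volume.restrict Ω), DoublingPhi β C (φ x)) {ε : ℝ≥0∞} (hε : 0 < ε) :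
    ∃ m : ℝ≥0∞, 0 < m ∧ ∀ G : E n → E n, modular Ω φ G ≤ m → ∫⁻ x in Ω, ‖G x‖ₑ ≤ ε := by
  have hε2 : ε / 2 ≠ 0 := (ENNReal.half_pos hε.ne').ne'
  obtain ⟨d, hd, hdε⟩ := ENNReal.exists_nnreal_pos_mul_lt
    (hΩb.measure_lt_top (μ := volume)).ne hε2
  obtain ⟨m, hm, hmε⟩ := ENNReal.exists_nnreal_pos_mul_lt
    (ENNReal.coe_ne_top (r := d * C (β⁻¹ / d))) hε2
  refine ⟨m, ENNReal.coe_pos.2 hm, fun G hG => ?_⟩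
  calc ∫⁻ x in Ω, ‖G x‖ₑ ≤ d * volume Ω + (d * C (β⁻¹ / d) : ℝ≥0) * modular Ω φ G :=
        lintegral_le_modular hφ hd
    _ ≤ ε / 2 + ε / 2 := by
        refine add_le_add hdε.le (le_trans ?_ hmε.le)
        rw [mul_comm]
        gcongr
    _ = ε := ENNReal.add_halves ε

theorem exists_admissible_of_capacity_eq_zero {A K : Set (E n)} (hcap : capacity Ω φ A = 0)
    (hK : IsCompact K) (hKA : K ⊆ A) {ε : ℝ≥0∞} (hε : 0 < ε) :
    ∃ f G, IsAdmissible Ω φ K f G ∧ modular Ω φ G < ε := by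
  rw [← hcap] at hε
  simp only [capacity, iInf_lt_iff] at hε
  obtain ⟨U, ⟨-, hAU, -⟩, hlt⟩ := hε
  have h1 : capCompact Ω φ K < ε :=
    (le_iSup₂ (f := fun K (_ : IsCompact K ∧ K ⊆ U) => capCompact Ω φ K) K
      ⟨hK, hKA.trans hAU⟩).trans_lt hlt
  simp only [capCompact, iInf_lt_iff] at h1
  obtain ⟨f, G, hf, hlt⟩ := h1
  exact ⟨f, G, hf, hlt⟩

/-- The approximant is `η * (1 - h)` with `h` a truncated mollification of `f`. `Q` depends on `η`
but not on `f`, so `f` can be chosen afterwards. -/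
theorem exists_modular_cutoff_bound (hn : 2 ≤ n) (hΩ : IsOpen Ω) (hΩb : Bornology.IsBounded Ω)
    (hm : ∀ s : ℝ≥0, AEMeasurable (fun x => φ x s) (volume.restrict Ω)) (hβ : 0 < β)
    (hφ : ∀ᵐ x ∂(volume.restrict Ω), DoublingPhi β C (φ x)) (hA1 : CondA1 Ω φ)
    {A : Set (E n)} {η : E n → ℝ} (hη : IsTestFunction Ω η) :
    ∃ Q : ℝ≥0, ∀ f G, IsAdmissible Ω φ (tsupport η ∩ A) f G → 2 ^ n * modular Ω φ G < 1 →
      ∃ u, IsTestFunction (Ω \ A) u ∧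
        modular Ω φ (fun x => u x - η x) ≤ Q * (∫⁻ x in Ω, ‖G x‖ₑ) ∧
        modular Ω φ (fun x => gradient u x - gradient η x)
          ≤ Q * ((∫⁻ x in Ω, ‖G x‖ₑ) + modular Ω φ G) := by
  obtain ⟨P, hP⟩ := exists_poincare hn hΩb
  obtain ⟨Q, hQ⟩ := exists_modular_le_of_le_mollify hΩ hm hβ hφ hA1
  obtain ⟨ψ, L, hψ, hL, hψ0, hψ1, hψI⟩ := exists_smooth_truncation
  obtain ⟨T, hT, hT1, hT2⟩ := hη.exists_bound
  -- Slope of the linear bound on `[0, T]`, times the bound `T` for `η` and its gradient, times the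
  -- constant `L * P` from `∫ |h| ≤ L P ∫ |G|`.
  set c : ℝ≥0 := C (T / β) / T * (T * L * P) with hc
  refine ⟨c + C 2 * c + C 2 * (C (T * L) * Q), fun f G hf hsmall => ?_⟩
  obtain ⟨v, V, δ, ρ, hδ, hρ, hv, hvs, hV, hKV, hvV, hgrad⟩ := exists_smooth_capacity_test hΩ hf
  have hv1 : ContDiff ℝ 1 v := hv.of_le (by exact_mod_cast le_top)
  have hvd : Differentiable ℝ v := hv1.differentiable one_ne_zero
  have hψd : Differentiable ℝ ψ := hψ.differentiable (by simp)
  have hGe : AEMeasurable (fun y => ‖G y‖ₑ) (volume.restrict Ω) :=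
    hf.isSobolev.integrable_grad.aestronglyMeasurable.enorm
  set h : E n → ℝ := fun x => ψ (v x) with hh
  have hhs : ContDiff ℝ ((⊤ : ℕ∞) : WithTop ℕ∞) h := hψ.comp hv
  have hhd : Differentiable ℝ h := hψd.comp hvd
  have hh1 : ∀ x, ‖h x‖ ≤ 1 := fun x => by
    rw [Real.norm_of_nonneg (hψI _).1]; exact (hψI _).2
  have hint : ∫⁻ x in Ω, ‖h x‖ₑ ≤ (L * P : ℝ≥0) * ∫⁻ x in Ω, ‖G x‖ₑ := by
    calc ∫⁻ x in Ω, ‖h x‖ₑ ≤ ∫⁻ x, ‖h x‖ₑ := lintegral_mono' Measure.restrict_le_self le_rfl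
      _ ≤ ∫⁻ x, L * ‖v x‖ₑ := by
          refine lintegral_mono fun x => ?_
          have := hL.dist_le_mul (v x) 0
          rw [hψ0, dist_zero_right, dist_zero_right] at this
          rw [enorm_eq_nnnorm, enorm_eq_nnnorm, ← ENNReal.coe_mul]
          exact ENNReal.coe_le_coe.2 this
      _ ≤ L * (P * ∫⁻ x, ‖gradient v x‖ₑ) := by
          rw [lintegral_const_mul' _ _ ENNReal.coe_ne_top]
          gcongr
          exact hP v hv1 hvs
      _ ≤ L * (P * ∫⁻ x in Ω, ‖G x‖ₑ) := by
          rw [← hρ.lintegral_mollify hGe]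
          gcongr
          exact hgrad _
      _ = _ := by push_cast; ring
  have hmul : ∀ {F : Type} [NormedAddCommGroup F] [NormedSpace ℝ F] (w : E n → F),
      (∀ x, ‖w x‖ ≤ T) →
      modular Ω φ (fun x => h x • w x) ≤ c * ∫⁻ x in Ω, ‖G x‖ₑ := by
    intro F _ _ w hw
    calc modular Ω φ (fun x => h x • w x)
        ≤ (C (T / β) / T : ℝ≥0) * ∫⁻ x in Ω, ‖h x • w x‖ₑ := by
          refine modular_le_linear hβ hφ hT fun x => ?_
          rw [norm_smul]
          exact (mul_le_mul (hh1 x) (hw x) (norm_nonneg _) zero_le_one).trans (one_mul _).le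
      _ ≤ (C (T / β) / T : ℝ≥0) * ∫⁻ x in Ω, T * ‖h x‖ₑ := by
          gcongr with x
          rw [enorm_smul, mul_comm]
          gcongr
          exact ENNReal.coe_le_coe.2 (hw x)
      _ ≤ (C (T / β) / T : ℝ≥0) * (T * ((L * P : ℝ≥0) * ∫⁻ x in Ω, ‖G x‖ₑ)) := by
          rw [lintegral_const_mul' _ _ ENNReal.coe_ne_top]
          gcongr
      _ = _ := by rw [hc]; push_cast; ring
  have hgv : modular Ω φ (fun x => η x • gradient h x)
      ≤ C (T * L) * (Q * ((∫⁻ x in Ω, ‖G x‖ₑ) + modular Ω φ G)) := by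
    refine (modular_le_mul hφ (T * L) (h := gradient v) fun x => ?_).trans ?_
    · rw [norm_smul, NNReal.coe_mul, mul_assoc]
      exact mul_le_mul (hT1 x) (norm_gradient_comp_le hψd hL (hvd x)) (norm_nonneg _) T.2
    · rw [mul_add]
      gcongr
      exact hQ δ _ ρ hδ hρ G _ hf.isSobolev.integrable_grad (by exact_mod_cast hsmall) hgrad
  have huη : ∀ x, η x * (1 - h x) - η x = -(h x • η x) := fun x => by
    rw [smul_eq_mul]; ring
  have hgu : ∀ x, gradient (fun x => η x * (1 - h x)) x - gradient η x
      = -(h x • gradient η x + η x • gradient h x) := fun x => by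
    rw [gradient_fun_mul (hη.differentiable x) ((hhd x).const_sub 1),
      gradient_fun_sub (differentiableAt_const 1) (hhd x), gradient_fun_const]
    module
  refine ⟨fun x => η x * (1 - h x), ?_, ?_, ?_⟩
  · have hsupp : Function.support (fun x => η x * (1 - h x)) ⊆ tsupport η ∩ Vᶜ := fun x hx =>
      ⟨subset_tsupport _ (left_ne_zero_of_mul hx), fun hxV =>
        right_ne_zero_of_mul hx (by rw [hh]; simp only [hψ1 _ (hvV x hxV), sub_self])⟩
    have hu := hη.of_subset (hη.smooth.mul (contDiff_const.sub hhs)) (hsupp.trans inter_subset_left)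
    refine ⟨hu.smooth, hu.compactSupport, fun x hx => ⟨hu.support_subset hx, fun hxA => ?_⟩⟩
    have := closure_minimal hsupp ((isClosed_tsupport η).inter hV.isClosed_compl) hx
    exact this.2 (hKV ⟨this.1, hxA⟩)
  · calc modular Ω φ (fun x => η x * (1 - h x) - η x) = modular Ω φ (fun x => h x • η x) := by
          simp only [huη, modular, nnnorm_neg]
      _ ≤ c * ∫⁻ x in Ω, ‖G x‖ₑ := hmul η hT1
      _ ≤ _ := by
          gcongr
          rw [add_assoc]
          exact le_self_add
  · calc modular Ω φ (fun x => gradient (fun x => η x * (1 - h x)) x - gradient η x)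
        = modular Ω φ (fun x => h x • gradient η x + η x • gradient h x) := by
          simp only [hgu, modular, nnnorm_neg]
      _ ≤ C 2 * modular Ω φ (fun x => h x • gradient η x)
          + C 2 * modular Ω φ (fun x => η x • gradient h x) :=
          modular_add_le hm hφ
            (hhs.continuous.smul (continuous_gradient hη.contDiff_one)).aestronglyMeasurable
      _ ≤ C 2 * (c * ((∫⁻ x in Ω, ‖G x‖ₑ) + modular Ω φ G))
          + C 2 * (C (T * L) * (Q * ((∫⁻ x in Ω, ‖G x‖ₑ) + modular Ω φ G))) := by
          gcongr
          exact (hmul _ hT2).trans (by gcongr; exact le_self_add)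
      _ = (C 2 * c + C 2 * (C (T * L) * Q) : ℝ≥0) * ((∫⁻ x in Ω, ‖G x‖ₑ) + modular Ω φ G) := by
          push_cast; ring
      _ ≤ _ := by
          gcongr
          exact le_add_self

theorem exists_testFunction_diff_near (hn : 2 ≤ n) (hΩ : IsOpen Ω) (hΩb : Bornology.IsBounded Ω)
    (hm : ∀ s : ℝ≥0, AEMeasurable (fun x => φ x s) (volume.restrict Ω)) (hβ : 0 < β)
    (hφ : ∀ᵐ x ∂(volume.restrict Ω), DoublingPhi β C (φ x)) (hA1 : CondA1 Ω φ)
    {A : Set (E n)} (hAc : IsClosed ((↑) ⁻¹' A : Set Ω)) (hcap : capacity Ω φ A = 0)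
    {η : E n → ℝ} (hη : IsTestFunction Ω η) {ε : ℝ≥0∞} (hε : 0 < ε) :
    ∃ u, IsTestFunction (Ω \ A) u ∧ modular Ω φ (fun x => u x - η x) ≤ ε ∧
      modular Ω φ (fun x => gradient u x - gradient η x) ≤ ε := by
  obtain ⟨Q, hQ⟩ := exists_modular_cutoff_bound hn hΩ hΩb hm hβ hφ hA1 (A := A) hη
  -- `A` is closed only relative to `Ω`, but `tsupport η` is a compact subset of `Ω`.
  have hK : IsCompact (tsupport η ∩ A) := by
    obtain ⟨Z, hZ, hZA⟩ := isClosed_induced_iff.1 hAc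
    have : tsupport η ∩ A = tsupport η ∩ Z := by
      ext x
      refine and_congr_right fun hx => ?_
      exact (Set.ext_iff.1 hZA ⟨x, hη.support_subset hx⟩).symm
    rw [this]
    exact hη.compactSupport.isCompact.inter_right hZ
  obtain ⟨κ, hκ, hκε⟩ := ENNReal.exists_nnreal_pos_mul_lt (ENNReal.coe_ne_top (r := Q)) hε.ne'
  have hκ2 : (0 : ℝ≥0∞) < κ / 2 := ENNReal.half_pos (ENNReal.coe_pos.2 hκ).ne'
  obtain ⟨m, hm0, hmG⟩ := exists_modular_bound_lintegral_le hΩb hφ hκ2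
  have hpow : (0 : ℝ≥0∞) < (2 ^ n)⁻¹ := ENNReal.inv_pos.2 (by simp)
  obtain ⟨f, G, hf, hlt⟩ := exists_admissible_of_capacity_eq_zero hcap hK inter_subset_right
    (lt_min hpow (lt_min hm0 hκ2))
  -- The three thresholds serve the smallness condition for (A1), the `L¹` norm of `G`, and its
  -- modular.
  obtain ⟨h1, h2, h3⟩ : modular Ω φ G < (2 ^ n)⁻¹ ∧ modular Ω φ G < m ∧ modular Ω φ G < κ / 2 := by
    simpa only [lt_min_iff] using hlt
  have hsmall : 2 ^ n * modular Ω φ G < 1 := by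
    rw [mul_comm]
    exact ENNReal.mul_lt_of_lt_div (by rwa [one_div])
  obtain ⟨u, hu, hu1, hu2⟩ := hQ f G hf hsmall
  have hb : (∫⁻ x in Ω, ‖G x‖ₑ) + modular Ω φ G ≤ κ :=
    (add_le_add (hmG G h2.le) h3.le).trans (ENNReal.add_halves _).le
  have hb2 : Q * ((∫⁻ x in Ω, ‖G x‖ₑ) + modular Ω φ G) ≤ ε := by
    refine le_trans ?_ hκε.le
    rw [mul_comm]
    gcongr
  exact ⟨u, hu, hu1.trans (le_trans (by gcongr; exact le_self_add) hb2), hu2.trans hb2⟩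

/-- Test functions on `Ω` are norm dense by definition, so quasi-subadditivity of the modular
reduces the claim to them; errors `2⁻¹ ^ j` then give a.e. convergence as well. -/
theorem sobolevZeroEqDiff_of_capacity_eq_zero (hn : 2 ≤ n) (hΩ : IsOpen Ω)
    (hΩb : Bornology.IsBounded Ω)
    (hm : ∀ s : ℝ≥0, AEMeasurable (fun x => φ x s) (volume.restrict Ω)) (hβ : 0 < β)
    (hφ : ∀ᵐ x ∂(volume.restrict Ω), DoublingPhi β C (φ x)) (hA1 : CondA1 Ω φ)
    {A : Set (E n)} (hAc : IsClosed ((↑) ⁻¹' A : Set Ω)) (hcap : capacity Ω φ A = 0) :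
    SobolevZeroEqDiff Ω φ A := by
  intro w G hw
  have happrox : ∀ ε : ℝ≥0∞, 0 < ε → ε ≤ 1 → ∃ u, IsTestFunction (Ω \ A) u ∧
      modular Ω φ (fun x => u x - w x) ≤ C 2 * ε + C 2 * ε ∧
      modular Ω φ (fun x => gradient u x - G x) ≤ C 2 * ε + C 2 * ε := by
    intro ε hε hε1
    obtain ⟨η, hη, hlt⟩ := hw.approx ε hε
    obtain ⟨u, hu, hu1, hu2⟩ := exists_testFunction_diff_near hn hΩ hΩb hm hβ hφ hA1 hAc hcap hη hε
    have e1 := modular_lt_of_luxemburgNorm_lt hφ hε1 (le_self_add.trans_lt hlt)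
    have e2 := modular_lt_of_luxemburgNorm_lt hφ hε1 (le_add_self.trans_lt hlt)
    refine ⟨u, hu, ?_, ?_⟩
    · have := modular_add_le hm hφ (g := fun x => u x - η x) (h := fun x => η x - w x)
        (hu.continuous.sub hη.continuous).aestronglyMeasurable
      simp only [sub_add_sub_cancel] at this
      exact this.trans (by gcongr)
    · have := modular_add_le hm hφ (g := fun x => gradient u x - gradient η x)
        (h := fun x => gradient η x - G x)
        ((continuous_gradient hu.contDiff_one).sub
          (continuous_gradient hη.contDiff_one)).aestronglyMeasurable
      simp only [sub_add_sub_cancel] at this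
      exact this.trans (by gcongr)
  have hseq : ∀ j : ℕ, ∃ u, IsTestFunction (Ω \ A) u ∧
      modular Ω φ (fun x => u x - w x) ≤ 2⁻¹ ^ j ∧
      modular Ω φ (fun x => gradient u x - G x) ≤ 2⁻¹ ^ j := by
    intro j
    obtain ⟨κ, hκ, hκε⟩ := ENNReal.exists_nnreal_pos_mul_lt
      (ENNReal.coe_ne_top (r := C 2 + C 2)) (b := 2⁻¹ ^ j) (by simp)
    have hle : C 2 * min (κ : ℝ≥0∞) 1 + C 2 * min (κ : ℝ≥0∞) 1 ≤ 2⁻¹ ^ j := by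
      refine le_trans ?_ hκε.le
      rw [← add_mul, mul_comm, ENNReal.coe_add]
      gcongr
      exact min_le_left _ _
    -- The minimum with `1` is needed because a Luxemburg norm bounds the modular only below `1`.
    obtain ⟨u, hu, h1, h2⟩ := happrox (min κ 1) (lt_min (ENNReal.coe_pos.2 hκ) one_pos)
      (min_le_right _ _)
    exact ⟨u, hu, h1.trans hle, h2.trans hle⟩
  choose u hu h1 h2 using hseq
  exact ⟨u, hu, ae_tendsto_of_modular_le hm hφ
      (fun j => (hu j).continuous.aestronglyMeasurable)
      hw.isSobolev.integrable.aestronglyMeasurable h1,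
    ae_tendsto_of_modular_le hm hφ
      (fun j => (continuous_gradient (hu j).contDiff_one).aestronglyMeasurable)
      hw.isSobolev.integrable_grad.aestronglyMeasurable h2⟩

end Backward

end MusielakOrlicz

theorem lemma3p2 {n : ℕ} (hn : 2 ≤ n)
    (Ω : Set (EuclideanSpace ℝ (Fin n))) (hΩ : IsOpen Ω) (hΩb : Bornology.IsBounded Ω)
    (φ : EuclideanSpace ℝ (Fin n) → ℝ≥0 → ℝ≥0∞) (hφ : IsConvexPhi Ω φ)
    (hA0 : CondA0 Ω φ) (hA1 : CondA1 Ω φ)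
    (p q : ℝ) (hp : 1 < p) (hpq : p ≤ q) (hq : q ≤ n)
    (hInc : CondAInc Ω φ p) (hDec : CondADec Ω φ q)
    (A : Set (EuclideanSpace ℝ (Fin n))) (hA : A ⊆ Ω)
    (hAc : IsClosed ((↑) ⁻¹' A : Set Ω)) :
    SobolevZeroEqDiff Ω φ A ↔ capacity Ω φ A = 0 := by
  obtain ⟨β, C, hβ, hD⟩ := exists_doublingPhi hΩ hφ hA0 (by linarith : 0 ≤ q) hDec
  exact ⟨capacity_eq_zero_of_sobolevZeroEqDiff hΩ hΩb hφ.measurable hβ hD hA,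
    sobolevZeroEqDiff_of_capacity_eq_zero hn hΩ hΩb hφ.measurable hβ hD hA1 hAc⟩
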